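/- Let $I\subset\mathbb R$ be an interval (of finite or infinite length), let $\mathfrak F=\bigoplus_{n\ge 0}L^2(I)^{\odot n}$ be the bosonic Fock space over $L^2(I)$ with vacuum $|\Omega\rangle$, and let $\psi(x),\psi^\dagger(x)$ be the bosonic field operators, $[\psi(x),\psi^\dagger(y)]=\delta(x-y)$, $\psi(x)|\Omega\rangle=0$. Path-ordered exponentials $\mathcal P e^{\int_I G(x)\,dx}$ are understood as Dyson series $\sum_{m\ge0}\int_{x_1<\dots<x_m}G(x_1)\cdots G(x_m)\,dx_1\cdots dx_m$, evaluated in matrix elements $\langle\Psi|\cdot|\Phi\rangle$ with finite-particle vectors $\Psi$ on the left. For $B\in M_D(\mathbb C)$ and $Q,L:I\to M_D(\mathbb C)$ with $Q\in L^1(I)$, $L\in L^2(I)$, the continuous matrix product state (cMPS) of bond dimension $D$ with tensors $(B,Q,L)$ is $$|\psi[B,Q,L]\rangle=\operatorname{Tr}_D\Big(B\,\mathcal P e^{\int_I dx\,(Q(x)\otimes 1+L(x)\otimes\psi^\dagger(x))}\Big)|\Omega\rangle .$$ For, in addition, $R:I\to M_D(\mathbb C)$ in $L^2(I)$ and $T:I\to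 M_D(\mathbb C)$ in $L^\infty(I)$, the continuous matrix product operator (cMPO) of bond dimension $D$ is the (in general unbounded) operator on $\mathfrak F$, with its natural domain, $$O[B,Q,L,R,T]=\operatorname{Tr}_D\Big(B\,\mathcal P e^{\int_I dx\,\mathfrak L_x}\Big)(|\Omega\rangle\langle\Omega|),\qquad \mathfrak L_x=Q(x)\otimes\mathrm{Id}+L(x)\otimes l_x+R(x)\otimes r_x+T(x)\otimes\mathrm{Ad}_x,$$ where $l_x[A]=\psi^\dagger(x)A$, $r_x[A]=A\psi(x)$, $\mathrm{Ad}_x[A]=\psi^\dagger(x)A\psi(x)$. The domain consists of the vectors $\Phi\in\mathfrak F$ for which there is $\Xi\in\mathfrak F$ such that, for every finite-particle $\Psi$, the Dyson series for $\langle\Psi|O|\Phi\rangle$ converges absolutely to $\langle\Psi|\Xi\rangle$; then $O\Phi=\Xi$. Let $(B_2,Q_2,L_2)$ be tensors of a cMPS of bond dimension $D_2$, and let $O_1=O[B_1,Q_1,L_1,R_1,T_1]$ be a cMPO of bond dimension $D_1$, with tensors in the above classes. Then: 1. $|\psi[B_2,Q_2,L_2]\rangle$ is a well-defined vector of $\mathfrak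 F$, the vacuum lies in the domain of the cMPO $O_2=O[B_2,Q_2,L_2,0,\mathbb 1_{D_2}]$, and $|\psi[B_2,Q_2,L_2]\rangle=O_2|\Omega\rangle$. 2. $|\psi[B_2,Q_2,L_2]\rangle$ lies in the domain of $O_1$, and $O_1|\psi[B_2,Q_2,L_2]\rangle=|\psi[B,Q,L]\rangle$ is the cMPS with tensors $$B=B_1\otimes B_2,\qquad L=L_1\otimes\mathbb 1_{D_2}+T_1\otimes L_2,\qquad Q=Q_1\otimes\mathbb 1_{D_2}+\mathbb 1_{D_1}\otimes Q_2+R_1\otimes L_2,$$ where again $Q\in L^1(I)$ and $L\in L^2(I)$. In particular $O_1$ maps a cMPS of bond dimension $D_2$ to a cMPS of bond dimension at most $D_1D_2$. -/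

import Mathlib

open MeasureTheory
open scoped Kronecker ComplexConjugate

noncomputable section

namespace CMPO

/-! ### Fock space over `L²(I)` -/

/-- Lebesgue measure on `Iⁿ`. -/
abbrev cubeMeasure (I : Set ℝ) (n : ℕ) : Measure (Fin n → ℝ) :=
  Measure.pi fun _ => volume.restrict I

/-- Lebesgue measure on the path-ordered configurations `x₁ < ⋯ < xₘ` of points of `I`. -/
abbrev orderedMeasure (I : Set ℝ) (m : ℕ) : Measure (Fin m → ℝ) :=
  (cubeMeasure I m).restrict {x | StrictMono x}

theorem quasiMeasurePreserving_comp (I : Set ℝ) {n m : ℕ} (f : Fin n → Fin m)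
    (hf : Function.Injective f) :
    Measure.QuasiMeasurePreserving (fun (x : Fin m → ℝ) i => x (f i))
      (cubeMeasure I m) (cubeMeasure I n) := by
  classical
  obtain ⟨p, e, he⟩ : ∃ (p : Fin m → Prop) (e : Fin n ≃ {j // p j}), ∀ i, (e i : Fin m) = f i :=
    ⟨(· ∈ Set.range f), Equiv.ofInjective f hf, fun _ => rfl⟩
  have h1 := measurePreserving_piEquivPiSubtypeProd
    (fun _ : Fin m => (volume.restrict I : Measure ℝ)) p
  have h2 := Measure.quasiMeasurePreserving_fst.comp h1.quasiMeasurePreserving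
  have h3 := (measurePreserving_arrowCongr'
    (fun _ : {j // p j} => (volume.restrict I : Measure ℝ))
    (fun _ : Fin n => (volume.restrict I : Measure ℝ))
    e.symm (MeasurableEquiv.refl ℝ) (fun _ => MeasurePreserving.id _)).quasiMeasurePreserving
  convert h3.comp h2 using 1
  funext x i
  exact congrArg x (he i).symm

/-- The `n`-particle sector `L²(I)^{⊙n}`: the square-integrable functions on `Iⁿ` that are
invariant under permutations of the particles. -/
def sector (I : Set ℝ) (n : ℕ) : Submodule ℂ (Lp ℂ 2 (cubeMeasure I n)) where
  carrier := {f | ∀ σ : Equiv.Perm (Fin n),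
    (fun x : Fin n → ℝ => f (fun i => x (σ i))) =ᵐ[cubeMeasure I n] f}
  zero_mem' := fun σ => by
    have h0 := Lp.coeFn_zero ℂ 2 (cubeMeasure I n)
    exact ((quasiMeasurePreserving_comp I σ σ.injective).ae_eq_comp h0).trans h0.symm
  add_mem' := fun {f g} hf hg σ => by
    have h0 := Lp.coeFn_add f g
    refine ((quasiMeasurePreserving_comp I σ σ.injective).ae_eq_comp h0).trans
      (Filter.EventuallyEq.trans ?_ h0.symm)
    exact (hf σ).add (hg σ)
  smul_mem' := fun c f hf σ => by
    have h0 := Lp.coeFn_smul c f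
    refine ((quasiMeasurePreserving_comp I σ σ.injective).ae_eq_comp h0).trans
      (Filter.EventuallyEq.trans ?_ h0.symm)
    exact (hf σ).const_smul c

/-- The bosonic Fock space `⨁ₙ L²(I)^{⊙n}` (Hilbert sum). -/
abbrev Fock (I : Set ℝ) : Type := lp (fun n : ℕ => sector I n) 2

theorem memLp_one_zero (I : Set ℝ) :
    MemLp (fun _ : Fin 0 → ℝ => (1 : ℂ)) 2 (cubeMeasure I 0) := by
  have : IsFiniteMeasure (cubeMeasure I 0) := by
    rw [cubeMeasure, Measure.pi_of_empty]; infer_instance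
  exact memLp_const 1

/-- The Fock vacuum `|Ω⟩ = (1, 0, 0, …)`. -/
def vacuum (I : Set ℝ) : Fock I :=
  lp.single 2 0 ⟨(memLp_one_zero I).toLp _, fun σ => by
    filter_upwards with x
    congr 1
    exact Subsingleton.elim _ _⟩

/-- Vectors with finitely many non-zero particle sectors. -/
def FiniteParticle {I : Set ℝ} (Ψ : Fock I) : Prop := ∃ N : ℕ, ∀ n, N < n → Ψ n = 0

/-! ### Field operators and ladder maps

The annihilation operator `ψ(x)` acts on wavefunctions pointwise.  The creation operator `ψ†(x)`
is the adjoint of `ψ(x)` in the sense of forms, so a vector is represented by the functional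
`Ψ ↦ ⟨Ψ|χ⟩` and an operator by its matrix elements `(Ψ, Φ) ↦ ⟨Ψ|A|Φ⟩`. -/

/-- Wavefunctions with an arbitrary number of particles. -/
abbrev Wave : Type := (n : ℕ) → (Fin n → ℝ) → ℂ

/-- The wavefunction of a Fock vector. -/
def wave {I : Set ℝ} (Φ : Fock I) : Wave := fun n => ((Φ n : Lp ℂ 2 (cubeMeasure I n)) : _ → ℂ)

/-- `(ψ(x)φ)ₙ(y₁, …, yₙ) = √(n+1) φₙ₊₁(x, y₁, …, yₙ)`. -/
def annihilate (x : ℝ) (φ : Wave) : Wave :=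
  fun n y => (Real.sqrt (n + 1) : ℂ) * φ (n + 1) (Fin.cons x y)

/-- A generalized vector `χ`, given by `Ψ ↦ ⟨Ψ|χ⟩`. -/
abbrev VecForm : Type := Wave → ℂ

/-- A generalized operator `A`, given by `(Ψ, Φ) ↦ ⟨Ψ|A|Φ⟩`. -/
abbrev OpForm : Type := Wave → Wave → ℂ

/-- `|Ω⟩`. -/
def vacuumVec : VecForm := fun Ψ => conj (Ψ 0 ![])

/-- `ψ†(x)χ`, that is `⟨Ψ|ψ†(x)χ⟩ = ⟨ψ(x)Ψ|χ⟩`. -/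
def create (x : ℝ) (χ : VecForm) : VecForm := fun Ψ => χ (annihilate x Ψ)

/-- `|Ω⟩⟨Ω|`. -/
def vacuumProj : OpForm := fun Ψ Φ => conj (Ψ 0 ![]) * Φ 0 ![]

/-- `l_x[A] = ψ†(x) A`. -/
def leftMap (x : ℝ) (A : OpForm) : OpForm := fun Ψ Φ => A (annihilate x Ψ) Φ

/-- `r_x[A] = A ψ(x)`. -/
def rightMap (x : ℝ) (A : OpForm) : OpForm := fun Ψ Φ => A Ψ (annihilate x Φ)

/-- `Ad_x[A] = ψ†(x) A ψ(x)`. -/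
def adMap (x : ℝ) (A : OpForm) : OpForm := fun Ψ Φ => A (annihilate x Ψ) (annihilate x Φ)

/-! ### Path-ordered exponentials -/

section Bond

variable {ι : Type} [Fintype ι] [DecidableEq ι]

/-- `A ⊗ s` for a matrix `A` on the bond space and a map `s` on a space `V` of generalized vectors
or operators. -/
def bondTensor {V : Type} [AddCommMonoid V] [Module ℂ V] (A : Matrix ι ι ℂ) (s : V → V)
    (M : Matrix ι ι V) : Matrix ι ι V :=
  Matrix.of fun i j => ∑ k, A i k • s (M k j)

/-- `Tr_D(B M)`, the trace over the bond space. -/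
def bondTrace {V : Type} [AddCommMonoid V] [Module ℂ V] (B : Matrix ι ι ℂ) (M : Matrix ι ι V) : V :=
  ∑ i, ∑ k, B i k • M k i

/-- `G(x₁) G(x₂) ⋯ G(xₘ) w`. -/
def pathProduct {W : Type} (G : ℝ → W → W) (w : W) {m : ℕ} (x : Fin m → ℝ) : W :=
  (List.ofFn x).foldr G w

/-- `∑ₘ ∫_{x₁ < ⋯ < xₘ} F m x dx = s`, where all integrals and the series converge absolutely. -/
def HasDysonSum (I : Set ℝ) (F : (m : ℕ) → (Fin m → ℝ) → ℂ) (s : ℂ) : Prop :=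
  (∀ m, Integrable (F m) (orderedMeasure I m)) ∧
    HasSum (fun m => ∫ x, F m x ∂(orderedMeasure I m)) s

/-- `Q(x) ⊗ 1 + L(x) ⊗ ψ†(x)`. -/
def stateGenerator (Q L : ℝ → Matrix ι ι ℂ) (x : ℝ) (M : Matrix ι ι VecForm) :
    Matrix ι ι VecForm :=
  bondTensor (Q x) id M + bondTensor (L x) (create x) M

/-- The `m`-th integrand of the Dyson series of `Tr_D(B 𝒫exp ∫ (Q ⊗ 1 + L ⊗ ψ†)) |Ω⟩`. -/
def stateIntegrand (B : Matrix ι ι ℂ) (Q L : ℝ → Matrix ι ι ℂ) (m : ℕ) (x : Fin m → ℝ) : VecForm :=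
  bondTrace B (pathProduct (stateGenerator Q L) (Matrix.diagonal fun _ => vacuumVec) x)

/-- `Φ` is the continuous matrix product state
`|ψ[B,Q,L]⟩ = Tr_D(B 𝒫exp ∫_I (Q(x) ⊗ 1 + L(x) ⊗ ψ†(x)) dx) |Ω⟩`. -/
def IsCMPS (I : Set ℝ) (B : Matrix ι ι ℂ) (Q L : ℝ → Matrix ι ι ℂ) (Φ : Fock I) : Prop :=
  ∀ Ψ : Fock I, FiniteParticle Ψ →
    HasDysonSum I (fun m x => stateIntegrand B Q L m x (wave Ψ)) (inner ℂ Ψ Φ)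

/-- `𝔏_x = Q(x) ⊗ Id + L(x) ⊗ l_x + R(x) ⊗ r_x + T(x) ⊗ Ad_x`. -/
def operatorGenerator (Q L R T : ℝ → Matrix ι ι ℂ) (x : ℝ) (M : Matrix ι ι OpForm) :
    Matrix ι ι OpForm :=
  bondTensor (Q x) id M + bondTensor (L x) (leftMap x) M + bondTensor (R x) (rightMap x) M +
    bondTensor (T x) (adMap x) M

/-- The `m`-th integrand of the Dyson series of `Tr_D(B 𝒫exp ∫ 𝔏_x)(|Ω⟩⟨Ω|)`. -/
def operatorIntegrand (B : Matrix ι ι ℂ) (Q L R T : ℝ → Matrix ι ι ℂ) (m : ℕ) (x : Fin m → ℝ) :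
    OpForm :=
  bondTrace B (pathProduct (operatorGenerator Q L R T) (Matrix.diagonal fun _ => vacuumProj) x)

/-- `Ξ = Tr_D(B 𝒫exp ∫_I 𝔏_x dx)(|Ω⟩⟨Ω|) Φ`, tested against finite-particle vectors. -/
def OperatorAction (I : Set ℝ) (B : Matrix ι ι ℂ) (Q L R T : ℝ → Matrix ι ι ℂ) (Φ Ξ : Fock I) :
    Prop :=
  ∀ Ψ : Fock I, FiniteParticle Ψ →
    HasDysonSum I (fun m x => operatorIntegrand B Q L R T m x (wave Ψ) (wave Φ)) (inner ℂ Ψ Ξ)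

/-! The action is linear and single-valued, so it defines a partially defined linear operator. -/

theorem ext_finiteParticle {I : Set ℝ} {Ξ Ξ' : Fock I}
    (h : ∀ Ψ : Fock I, FiniteParticle Ψ → (inner ℂ Ψ Ξ : ℂ) = inner ℂ Ψ Ξ') : Ξ = Ξ' := by
  ext1
  funext n
  refine ext_inner_left ℂ fun v => ?_
  have := h (lp.single 2 n v) ⟨n, fun k hk => lp.single_apply_ne _ _ _ (by omega)⟩
  rwa [lp.inner_single_left, lp.inner_single_left] at this

theorem OperatorAction.unique {I : Set ℝ} {B : Matrix ι ι ℂ} {Q L R T : ℝ → Matrix ι ι ℂ}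
    {Φ Ξ Ξ' : Fock I} (h : OperatorAction I B Q L R T Φ Ξ) (h' : OperatorAction I B Q L R T Φ Ξ') :
    Ξ = Ξ' :=
  ext_finiteParticle fun Ψ hΨ => (h Ψ hΨ).2.unique (h' Ψ hΨ).2

theorem pathProduct_linear (Q L R T : ℝ → Matrix ι ι ℂ) (a b : ℂ) :
    ∀ (m : ℕ) (x : Fin m → ℝ) (ψ φ φ₁ φ₂ : Wave),
      (∀ (n : ℕ) (f : Fin n → Fin m), Function.Injective f →
        φ n (fun i => x (f i)) = a * φ₁ n (fun i => x (f i)) + b * φ₂ n (fun i => x (f i))) →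
      ∀ i j,
        pathProduct (operatorGenerator Q L R T) (Matrix.diagonal fun _ => vacuumProj) x i j ψ φ =
          a * pathProduct (operatorGenerator Q L R T) (Matrix.diagonal fun _ => vacuumProj)
              x i j ψ φ₁ +
          b * pathProduct (operatorGenerator Q L R T) (Matrix.diagonal fun _ => vacuumProj)
              x i j ψ φ₂ := by
  intro m
  induction m with
  | zero =>
    intro x ψ φ φ₁ φ₂ h i j
    have h0 := h 0 ![] (fun i => i.elim0)
    have e : (fun i => x ((![] : Fin 0 → Fin 0) i)) = ![] := Subsingleton.elim _ _
    rw [e] at h0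
    by_cases hij : i = j
    · subst hij
      simp only [pathProduct, List.ofFn_zero, List.foldr_nil, Matrix.diagonal_apply_eq, vacuumProj,
        h0]
      ring
    · simp [pathProduct, Matrix.diagonal_apply_ne _ hij]
  | succ m ih =>
    intro x ψ φ φ₁ φ₂ h i j
    have hstep : ∀ (χ θ : Wave),
        pathProduct (operatorGenerator Q L R T) (Matrix.diagonal fun _ => vacuumProj) x i j χ θ =
        ∑ k, (Q (x 0) i k * pathProduct (operatorGenerator Q L R T)
              (Matrix.diagonal fun _ => vacuumProj) (fun l : Fin m => x l.succ) k j χ θ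
          + L (x 0) i k * pathProduct (operatorGenerator Q L R T)
              (Matrix.diagonal fun _ => vacuumProj) (fun l : Fin m => x l.succ) k j
              (annihilate (x 0) χ) θ
          + R (x 0) i k * pathProduct (operatorGenerator Q L R T)
              (Matrix.diagonal fun _ => vacuumProj) (fun l : Fin m => x l.succ) k j
              χ (annihilate (x 0) θ)
          + T (x 0) i k * pathProduct (operatorGenerator Q L R T)
              (Matrix.diagonal fun _ => vacuumProj) (fun l : Fin m => x l.succ) k j
              (annihilate (x 0) χ) (annihilate (x 0) θ)) := by
      intro χ θ
      simp only [pathProduct, List.ofFn_succ, List.foldr_cons]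
      rw [operatorGenerator]
      simp [bondTensor, leftMap, rightMap, adMap, Finset.sum_add_distrib, Finset.sum_apply]
    have h1 : ∀ χ k, _ := fun χ k => ih (fun l => x l.succ) χ φ φ₁ φ₂
      (fun n f hf => h n (fun i => (f i).succ) fun _ _ e => hf (Fin.succ_injective _ e)) k j
    have h2 : ∀ χ k, _ := fun χ k => ih (fun l => x l.succ) χ (annihilate (x 0) φ)
      (annihilate (x 0) φ₁) (annihilate (x 0) φ₂)
      (fun n f hf => by
        have e : (Fin.cons (x 0) fun i => x (f i).succ : Fin (n + 1) → ℝ) =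
            fun i => x ((Fin.cons 0 fun i => (f i).succ : Fin (n + 1) → Fin (m + 1)) i) := by
          funext i
          refine Fin.cases ?_ (fun i => ?_) i <;> simp
        have hinj : Function.Injective
            (Fin.cons 0 fun i => (f i).succ : Fin (n + 1) → Fin (m + 1)) := by
          rw [Fin.cons_injective_iff]
          refine ⟨?_, fun _ _ e => hf (Fin.succ_injective _ e)⟩
          rintro ⟨i, hi⟩
          exact Fin.succ_ne_zero _ hi
        have := h (n + 1) _ hinj
        simp only [annihilate]
        rw [e, this]
        ring) k j
    rw [hstep ψ φ, hstep ψ φ₁, hstep ψ φ₂, Finset.mul_sum, Finset.mul_sum,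
      ← Finset.sum_add_distrib]
    refine Finset.sum_congr rfl fun k _ => ?_
    rw [h1, h1, h2, h2]
    ring

theorem operatorIntegrand_linear (I : Set ℝ) (B : Matrix ι ι ℂ) (Q L R T : ℝ → Matrix ι ι ℂ)
    (a b : ℂ) (Φ₁ Φ₂ : Fock I) (ψ : Wave) (m : ℕ) :
    (fun x => operatorIntegrand B Q L R T m x ψ (wave (a • Φ₁ + b • Φ₂)))
      =ᵐ[orderedMeasure I m]
    (fun x => a * operatorIntegrand B Q L R T m x ψ (wave Φ₁) +
      b * operatorIntegrand B Q L R T m x ψ (wave Φ₂)) := by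
  have hw : ∀ n, wave (a • Φ₁ + b • Φ₂) n =ᵐ[cubeMeasure I n]
      fun y => a * wave Φ₁ n y + b * wave Φ₂ n y := by
    intro n
    have e : (((a • Φ₁ + b • Φ₂ : Fock I) n : sector I n) : Lp ℂ 2 (cubeMeasure I n)) =
        a • (Φ₁ n : Lp ℂ 2 (cubeMeasure I n)) + b • (Φ₂ n : Lp ℂ 2 (cubeMeasure I n)) := rfl
    unfold wave
    rw [e]
    filter_upwards [Lp.coeFn_add (a • (Φ₁ n : Lp ℂ 2 (cubeMeasure I n)))
      (b • (Φ₂ n : Lp ℂ 2 (cubeMeasure I n))), Lp.coeFn_smul a (Φ₁ n : Lp ℂ 2 (cubeMeasure I n)),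
      Lp.coeFn_smul b (Φ₂ n : Lp ℂ 2 (cubeMeasure I n))] with y h1 h2 h3
    rw [h1, Pi.add_apply, h2, h3]
    rfl
  have hall : ∀ᵐ x ∂(cubeMeasure I m), ∀ (n : ℕ) (f : Fin n → Fin m), Function.Injective f →
      wave (a • Φ₁ + b • Φ₂) n (fun i => x (f i)) =
        a * wave Φ₁ n (fun i => x (f i)) + b * wave Φ₂ n (fun i => x (f i)) := by
    rw [ae_all_iff]; intro n
    rw [ae_all_iff]; intro f
    by_cases hf : Function.Injective f
    · filter_upwards [(quasiMeasurePreserving_comp I f hf).ae (hw n)] with x hx _ using hx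
    · exact Filter.Eventually.of_forall fun x h => absurd h hf
  filter_upwards [ae_restrict_of_ae hall] with x hx
  have key := pathProduct_linear Q L R T a b m x ψ _ _ _ hx
  simp only [operatorIntegrand, bondTrace, Finset.sum_apply, Pi.smul_apply, smul_eq_mul, key,
    Finset.mul_sum, ← Finset.sum_add_distrib]
  refine Finset.sum_congr rfl fun i _ => Finset.sum_congr rfl fun k _ => ?_
  ring

theorem OperatorAction.linear {I : Set ℝ} {B : Matrix ι ι ℂ} {Q L R T : ℝ → Matrix ι ι ℂ}
    {Φ₁ Φ₂ Ξ₁ Ξ₂ : Fock I} (h₁ : OperatorAction I B Q L R T Φ₁ Ξ₁)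
    (h₂ : OperatorAction I B Q L R T Φ₂ Ξ₂) (a b : ℂ) :
    OperatorAction I B Q L R T (a • Φ₁ + b • Φ₂) (a • Ξ₁ + b • Ξ₂) := by
  intro Ψ hΨ
  obtain ⟨i₁, s₁⟩ := h₁ Ψ hΨ
  obtain ⟨i₂, s₂⟩ := h₂ Ψ hΨ
  have hl := operatorIntegrand_linear I B Q L R T a b Φ₁ Φ₂ (wave Ψ)
  refine ⟨fun m => (((i₁ m).const_mul a).add ((i₂ m).const_mul b)).congr (hl m).symm, ?_⟩
  rw [inner_add_right, inner_smul_right, inner_smul_right]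
  have hs : ∀ m, ∫ x, operatorIntegrand B Q L R T m x (wave Ψ) (wave (a • Φ₁ + b • Φ₂))
      ∂(orderedMeasure I m) =
      a * ∫ x, operatorIntegrand B Q L R T m x (wave Ψ) (wave Φ₁) ∂(orderedMeasure I m) +
      b * ∫ x, operatorIntegrand B Q L R T m x (wave Ψ) (wave Φ₂) ∂(orderedMeasure I m) :=
    fun m => by
      rw [integral_congr_ae (hl m), integral_add ((i₁ m).const_mul a) ((i₂ m).const_mul b),
        integral_const_mul, integral_const_mul]
  simp only [hs]
  exact (s₁.mul_left a).add (s₂.mul_left b)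

theorem OperatorAction.zero (I : Set ℝ) (B : Matrix ι ι ℂ) (Q L R T : ℝ → Matrix ι ι ℂ) :
    OperatorAction I B Q L R T 0 0 := by
  intro Ψ hΨ
  have hl : ∀ m, (fun x => operatorIntegrand B Q L R T m x (wave Ψ) (wave (0 : Fock I)))
      =ᵐ[orderedMeasure I m] fun _ => 0 := fun m => by
    have := operatorIntegrand_linear I B Q L R T 0 0 0 0 (wave Ψ) m
    simpa using this
  refine ⟨fun m => (integrable_zero _ _ _).congr (hl m).symm, ?_⟩
  rw [inner_zero_right]
  have hz : ∀ m, ∫ x, operatorIntegrand B Q L R T m x (wave Ψ) (wave (0 : Fock I))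
      ∂(orderedMeasure I m) = 0 := fun m => by rw [integral_congr_ae (hl m), integral_zero]
  simp only [hz]
  exact hasSum_zero

/-- The continuous matrix product operator
`O[B,Q,L,R,T] = Tr_D(B 𝒫exp ∫_I 𝔏_x dx)(|Ω⟩⟨Ω|)` on its natural domain in Fock space. -/
def cMPO (I : Set ℝ) (B : Matrix ι ι ℂ) (Q L R T : ℝ → Matrix ι ι ℂ) : Fock I →ₗ.[ℂ] Fock I where
  domain :=
    { carrier := {Φ | ∃ Ξ, OperatorAction I B Q L R T Φ Ξ}
      zero_mem' := ⟨0, OperatorAction.zero I B Q L R T⟩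
      add_mem' := fun {Φ₁ Φ₂} ⟨Ξ₁, h₁⟩ ⟨Ξ₂, h₂⟩ => ⟨Ξ₁ + Ξ₂, by simpa using h₁.linear h₂ 1 1⟩
      smul_mem' := fun c Φ ⟨Ξ, h⟩ => ⟨c • Ξ, by simpa using h.linear h c 0⟩ }
  toFun :=
    { toFun := fun Φ => Φ.2.choose
      map_add' := fun Φ₁ Φ₂ => OperatorAction.unique (Φ₁ + Φ₂).2.choose_spec
        (by simpa using Φ₁.2.choose_spec.linear Φ₂.2.choose_spec 1 1)
      map_smul' := fun c Φ => OperatorAction.unique (c • Φ).2.choose_spec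
        (by simpa using Φ.2.choose_spec.linear Φ.2.choose_spec c 0) }

theorem cMPO_apply_eq_iff {I : Set ℝ} {B : Matrix ι ι ℂ} {Q L R T : ℝ → Matrix ι ι ℂ}
    {Φ Ξ : Fock I} :
    (∃ h : Φ ∈ (cMPO I B Q L R T).domain, cMPO I B Q L R T ⟨Φ, h⟩ = Ξ) ↔
      OperatorAction I B Q L R T Φ Ξ := by
  constructor
  · rintro ⟨h, rfl⟩
    exact h.choose_spec
  · intro h
    have hd : Φ ∈ (cMPO I B Q L R T).domain := ⟨Ξ, h⟩
    exact ⟨hd, OperatorAction.unique hd.choose_spec h⟩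

/-- Regularity of the tensors of a cMPS: `Q ∈ L¹(I)`, `L ∈ L²(I)`. -/
def StateTensors (I : Set ℝ) (Q L : ℝ → Matrix ι ι ℂ) : Prop :=
  (∀ i j, MemLp (fun x => Q x i j) 1 (volume.restrict I)) ∧
    ∀ i j, MemLp (fun x => L x i j) 2 (volume.restrict I)

/-- Regularity of the tensors of a cMPO: `Q ∈ L¹(I)`, `L, R ∈ L²(I)`, `T ∈ L^∞(I)`. -/
def OperatorTensors (I : Set ℝ) (Q L R T : ℝ → Matrix ι ι ℂ) : Prop :=
  StateTensors I Q L ∧ (∀ i j, MemLp (fun x => R x i j) 2 (volume.restrict I)) ∧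
    ∀ i j, MemLp (fun x => T x i j) ⊤ (volume.restrict I)

end Bond

end CMPO

end

/-!
A vector of Fock space is a function `σ ↦ ⟨σ|Φ⟩` of the finite set `σ` of particle positions, and
`⟨Ψ|Φ⟩` is an integral over all such sets.  Annihilating a particle at a point to the left of `σ`
means inserting that point in `σ`, so the matrix elements in the Dyson series are sums over the
subsets of `{x₁, …, xₘ}` of path-ordered products of tensors.  The integral over a set `ρ` of a sum
over its subsets `σ` is the double integral over `σ` and `ρ \ σ`.  Hence the cMPS has the amplitude
`σ ↦ ∫ Tr(B ∏ (L on σ, Q on τ)) dτ`, bounded by a product of `L²` functions of the points.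

When the tensors of the operator and of the state commute, as `A ⊗ 1` and `1 ⊗ A'` do,
multiplying out `∏ (Q₁ + Q₂ + R₁ L₂)` and `∏ (L₁ + T₁ L₂)` yields exactly the terms of the Dyson
series of the operator applied to the state.  For matrices this is the formula for the image
tensors; for the norms of the tensors it is the integrable bound which justifies interchanging
the integrals.
-/

noncomputable section

namespace CMPO

/-! ### Path-ordered products over finite sets of points -/

section OrderedProd

variable {α A : Type*} [LinearOrder α]

/-- The path-ordered product of the values of `f` over the points of `σ`: the factors appear in
increasing order of the points. -/
def orderedProd [Monoid A] (f : α → A) (σ : Finset α) : A :=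
  ((σ.sort (· ≤ ·)).map f).prod

/-- The factor which the generator `𝔏` contributes at each point of a term of the Dyson series in
which `S` is the set of points where a particle is created and `U` the set of points where one is
annihilated. -/
def ladderFactor (S U : Finset α) (Q L R T : α → A) : α → A :=
  U.piecewise (S.piecewise T R) (S.piecewise L Q)

theorem map_piecewise {A' : Type*} (φ : A → A') (S : Finset α) (f g : α → A) (t : α) :
    φ (S.piecewise f g t) = S.piecewise (fun t => φ (f t)) (fun t => φ (g t)) t :=
  apply_ite φ _ _ _

theorem map_ladderFactor {A' : Type*} (φ : A → A') (S U : Finset α) (Q L R T : α → A) (t : α) :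
    φ (ladderFactor S U Q L R T t) =
      ladderFactor S U (fun t => φ (Q t)) (fun t => φ (L t)) (fun t => φ (R t))
        (fun t => φ (T t)) t := by
  simp only [ladderFactor, Finset.piecewise]
  split_ifs <;> rfl

section Monoid

variable [Monoid A]

@[simp]
theorem orderedProd_empty (f : α → A) : orderedProd f ∅ = 1 := by
  simp [orderedProd]

theorem orderedProd_insert (f : α → A) {a : α} {σ : Finset α} (ha : ∀ b ∈ σ, a < b) :
    orderedProd f (insert a σ) = f a * orderedProd f σ := by
  simp only [orderedProd, Finset.sort_insert (· ≤ ·) (fun b hb => (ha b hb).le)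
    fun h => lt_irrefl a (ha a h), List.map_cons, List.prod_cons]

theorem orderedProd_congr {f g : α → A} {σ : Finset α} (h : ∀ t ∈ σ, f t = g t) :
    orderedProd f σ = orderedProd g σ := by
  unfold orderedProd
  rw [List.map_congr_left fun t ht => h t ((Finset.mem_sort _).1 ht)]

theorem orderedProd_piecewise_insert (f g : α → A) {a : α} {σ : Finset α} (ha : ∀ b ∈ σ, a < b)
    (S : Finset α) :
    orderedProd ((insert a S).piecewise f g) σ = orderedProd (S.piecewise f g) σ :=
  orderedProd_congr fun t ht => S.piecewise_insert_of_ne _ _ (ha t ht).ne'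

theorem map_orderedProd {A' F : Type*} [Monoid A'] [FunLike F A A'] [MonoidHomClass F A A']
    (φ : F) (f : α → A) (σ : Finset α) :
    φ (orderedProd f σ) = orderedProd (fun t => φ (f t)) σ := by
  simp only [orderedProd, map_list_prod, List.map_map, Function.comp_def]

theorem commute_orderedProd {b : A} {f : α → A} (h : ∀ t, Commute b (f t)) (σ : Finset α) :
    Commute b (orderedProd f σ) :=
  Commute.list_prod_right _ _ fun _ hc => by
    obtain ⟨t, -, rfl⟩ := List.mem_map.1 hc
    exact h t

end Monoid

theorem orderedProd_eq_zero [MonoidWithZero A] {f : α → A} {σ : Finset α} {t : α} (ht : t ∈ σ)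
    (hf : f t = 0) : orderedProd f σ = 0 :=
  List.prod_eq_zero (List.mem_map.2 ⟨t, (Finset.mem_sort _).2 ht, hf⟩)

theorem orderedProd_eq_prod [CommMonoid A] (f : α → A) (σ : Finset α) :
    orderedProd f σ = ∏ t ∈ σ, f t := by
  rw [← Finset.prod_map_toList]
  exact ((Finset.sort_perm_toList σ _).map f).prod_eq

section Semiring

variable [Semiring A]

section Expansion

variable {a b q ℓ : α → A} {x : α} {ρ σ : Finset α}

theorem sum_orderedProd_mul_insert (hq : ∀ s t (U : Finset α), Commute (q s) (U.piecewise b a t))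
    (hx : ∀ t ∈ ρ, x < t) (hσ : σ ⊆ ρ) :
    ∑ U ∈ σ.powerset, orderedProd (U.piecewise b a) σ *
        orderedProd (U.piecewise ℓ q) (U ∪ insert x ρ \ σ) =
      q x * ∑ U ∈ σ.powerset, orderedProd (U.piecewise b a) σ *
        orderedProd (U.piecewise ℓ q) (U ∪ ρ \ σ) := by
  have hxσ : x ∉ σ := fun h => lt_irrefl x (hx x (hσ h))
  rw [Finset.mul_sum]
  refine Finset.sum_congr rfl fun U hU => ?_
  have hUσ := Finset.mem_powerset.1 hU
  have hUρ : ∀ t ∈ U ∪ ρ \ σ, x < t := fun t ht =>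
    hx t (Finset.union_subset (hUσ.trans hσ) Finset.sdiff_subset ht)
  rw [Finset.insert_sdiff_of_notMem _ hxσ, Finset.union_insert, orderedProd_insert _ hUρ,
    Finset.piecewise_eq_of_notMem _ _ _ (fun h => hxσ (hUσ h)),
    (commute_orderedProd (fun t => hq x t U) σ).symm.left_comm]

theorem sum_orderedProd_mul_insert_insert
    (hℓ : ∀ s t (U : Finset α), Commute (ℓ s) (U.piecewise b a t))
    (hx : ∀ t ∈ ρ, x < t) (hσ : σ ⊆ ρ) :
    ∑ U ∈ (insert x σ).powerset, orderedProd (U.piecewise b a) (insert x σ) *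
        orderedProd (U.piecewise ℓ q) (U ∪ insert x ρ \ insert x σ) =
      (a x + b x * ℓ x) * ∑ U ∈ σ.powerset, orderedProd (U.piecewise b a) σ *
        orderedProd (U.piecewise ℓ q) (U ∪ ρ \ σ) := by
  have hxρ : x ∉ ρ := fun h => lt_irrefl x (hx x h)
  have hxσ : ∀ t ∈ σ, x < t := fun t ht => hx t (hσ ht)
  have hsdiff : insert x ρ \ insert x σ = ρ \ σ := by
    rw [Finset.insert_sdiff_insert, Finset.sdiff_insert_of_notMem hxρ]
  rw [Finset.sum_powerset_insert (fun h => hxρ (hσ h)), ← Finset.sum_add_distrib, Finset.mul_sum]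
  refine Finset.sum_congr rfl fun U hU => ?_
  have hUσ := Finset.mem_powerset.1 hU
  have hUρ : ∀ t ∈ U ∪ ρ \ σ, x < t := fun t ht =>
    hx t (Finset.union_subset (hUσ.trans hσ) Finset.sdiff_subset ht)
  rw [hsdiff, Finset.insert_union, orderedProd_insert _ hxσ, orderedProd_insert _ hxσ,
    orderedProd_insert _ hUρ, orderedProd_piecewise_insert _ _ hxσ,
    orderedProd_piecewise_insert _ _ hUρ, Finset.piecewise_insert_self,
    Finset.piecewise_insert_self, Finset.piecewise_eq_of_notMem _ _ _ (fun h => hxρ (hσ (hUσ h))),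
    add_mul, mul_assoc, mul_assoc, mul_assoc,
    (commute_orderedProd (fun t => hℓ x t U) σ).symm.left_comm]

/-- Expanding the product chooses one of the three summands at each point: `σ` collects the
points where `q` is not chosen and `U ⊆ σ` those where `b * ℓ` is chosen. -/
theorem orderedProd_add_mul_add (hq : ∀ s t (U : Finset α), Commute (q s) (U.piecewise b a t))
    (hℓ : ∀ s t (U : Finset α), Commute (ℓ s) (U.piecewise b a t)) (ρ : Finset α) :
    orderedProd (fun t => a t + b t * ℓ t + q t) ρ =
      ∑ σ ∈ ρ.powerset, ∑ U ∈ σ.powerset,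
        orderedProd (U.piecewise b a) σ * orderedProd (U.piecewise ℓ q) (U ∪ ρ \ σ) := by
  induction ρ using Finset.induction_on_min with
  | empty => simp
  | insert x ρ hx ih =>
    rw [Finset.sum_powerset_insert fun h => lt_irrefl x (hx x h),
      Finset.sum_congr rfl fun σ hσ =>
        sum_orderedProd_mul_insert hq hx (Finset.mem_powerset.1 hσ),
      Finset.sum_congr rfl fun σ hσ =>
        sum_orderedProd_mul_insert_insert hℓ hx (Finset.mem_powerset.1 hσ),
      ← Finset.mul_sum, ← Finset.mul_sum, ← ih, orderedProd_insert _ hx, ← add_mul, add_comm (q x)]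

end Expansion

/-- With `q = 0` on `S`, the terms of `orderedProd_add_mul_add` in which `S` is not contained in
`σ` vanish. -/
theorem orderedProd_piecewise_eq_sum (Q₁ L₁ R₁ T₁ Q₂ L₂ : α → A) {S ρ : Finset α} (hS : S ⊆ ρ)
    (hQ : ∀ s t U, Commute (Q₂ s) (ladderFactor S U Q₁ L₁ R₁ T₁ t))
    (hL : ∀ s t U, Commute (L₂ s) (ladderFactor S U Q₁ L₁ R₁ T₁ t)) :
    orderedProd (S.piecewise (fun t => L₁ t + T₁ t * L₂ t)
        fun t => Q₁ t + Q₂ t + R₁ t * L₂ t) ρ =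
      ∑ σ ∈ Finset.Icc S ρ, ∑ U ∈ σ.powerset,
        orderedProd (ladderFactor S U Q₁ L₁ R₁ T₁) σ *
          orderedProd (U.piecewise L₂ Q₂) (U ∪ ρ \ σ) := by
  have hq : ∀ s t U, Commute (S.piecewise (0 : α → A) Q₂ s) (ladderFactor S U Q₁ L₁ R₁ T₁ t) :=
    fun s t U => S.piecewise_cases (0 : α → A) Q₂ (Commute · _) (Commute.zero_left _) (hQ s t U)
  calc _ = orderedProd (fun t => S.piecewise L₁ Q₁ t + S.piecewise T₁ R₁ t * L₂ t +
        S.piecewise (0 : α → A) Q₂ t) ρ := orderedProd_congr fun t _ => by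
          by_cases ht : t ∈ S <;> simp [ht, add_right_comm]
    _ = ∑ σ ∈ ρ.powerset, ∑ U ∈ σ.powerset, orderedProd (ladderFactor S U Q₁ L₁ R₁ T₁) σ *
          orderedProd (U.piecewise L₂ (S.piecewise (0 : α → A) Q₂)) (U ∪ ρ \ σ) :=
        orderedProd_add_mul_add hq hL ρ
    _ = ∑ σ ∈ Finset.Icc S ρ, ∑ U ∈ σ.powerset, orderedProd (ladderFactor S U Q₁ L₁ R₁ T₁) σ *
          orderedProd (U.piecewise L₂ (S.piecewise (0 : α → A) Q₂)) (U ∪ ρ \ σ) := by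
        refine (Finset.sum_subset (fun σ hσ => ?_) fun σ hσ hSσ => ?_).symm
        · exact Finset.mem_powerset.2 (Finset.mem_Icc.1 hσ).2
        have hσρ := Finset.mem_powerset.1 hσ
        obtain ⟨t, htS, htσ⟩ := Finset.not_subset.1 fun h => hSσ (Finset.mem_Icc.2 ⟨h, hσρ⟩)
        refine Finset.sum_eq_zero fun U hU => ?_
        have htU : t ∉ U := fun h => htσ (Finset.mem_powerset.1 hU h)
        have ht : t ∈ U ∪ ρ \ σ := by simp [hS htS, htσ]
        rw [orderedProd_eq_zero (f := U.piecewise L₂ _) ht (by simp [htU, htS]), mul_zero]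
    _ = _ := by
        refine Finset.sum_congr rfl fun σ hσ => Finset.sum_congr rfl fun U _ => ?_
        have hSσ := (Finset.mem_Icc.1 hσ).1
        congr 1
        refine orderedProd_congr fun t ht => ?_
        by_cases htU : t ∈ U
        · simp [htU]
        · have htS : t ∉ S := fun h => by simp [htU, hSσ h] at ht
          simp [htU, htS]

theorem sum_smul_orderedProd_ladderFactor_mul {k : Type*} [Semiring k] [Module k A]
    (Q₁ L₁ R₁ T₁ Q₂ L₂ : α → A)
    (hQ : ∀ s t S U, Commute (Q₂ s) (ladderFactor S U Q₁ L₁ R₁ T₁ t))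
    (hL : ∀ s t S U, Commute (L₂ s) (ladderFactor S U Q₁ L₁ R₁ T₁ t))
    (ρ : Finset α) (c : Finset α → k) :
    ∑ σ ∈ ρ.powerset, ∑ S ∈ σ.powerset, ∑ U ∈ σ.powerset,
        c S • (orderedProd (ladderFactor S U Q₁ L₁ R₁ T₁) σ *
          orderedProd (U.piecewise L₂ Q₂) (U ∪ ρ \ σ)) =
      ∑ S ∈ ρ.powerset, c S • orderedProd (S.piecewise (fun t => L₁ t + T₁ t * L₂ t)
        fun t => Q₁ t + Q₂ t + R₁ t * L₂ t) ρ := by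
  rw [Finset.sum_comm' (t' := ρ.powerset) (s' := fun S => Finset.Icc S ρ)]
  · refine Finset.sum_congr rfl fun S hS => ?_
    simp only [orderedProd_piecewise_eq_sum Q₁ L₁ R₁ T₁ Q₂ L₂ (Finset.mem_powerset.1 hS)
      (fun s t => hQ s t S) (fun s t => hL s t S), Finset.smul_sum]
  · intro σ S
    simp only [Finset.mem_powerset, Finset.mem_Icc]
    exact ⟨fun ⟨hσ, hS⟩ => ⟨⟨hS, hσ⟩, hS.trans hσ⟩, fun ⟨⟨hS, hσ⟩, _⟩ => ⟨hσ, hS⟩⟩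

end Semiring

theorem sort_image {κ : Type*} [LinearOrder κ] {x : κ → α} (hx : StrictMono x) (S : Finset κ) :
    (S.image x).sort (· ≤ ·) = (S.sort (· ≤ ·)).map x := by
  have hmap : S.map ⟨x, hx.injective⟩ = S.image x := Finset.map_eq_image _ S
  rw [← hmap]
  exact (StrictMonoOn.map_finsetSort ⟨x, hx.injective⟩ S (hx.strictMonoOn _)).symm

theorem sort_image_univ {m : ℕ} {x : Fin m → α} (hx : StrictMono x) :
    (Finset.univ.image x).sort (· ≤ ·) = List.ofFn x := by
  rw [sort_image hx, Fin.sort_univ, List.ofFn_eq_map]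

theorem orderedProd_image [Monoid A] {κ : Type*} [LinearOrder κ] {x : κ → α} (hx : StrictMono x)
    (f : α → A) (S : Finset κ) : orderedProd f (S.image x) = orderedProd (fun a => f (x a)) S := by
  simp only [orderedProd, sort_image hx, List.map_map, Function.comp_def]

theorem piecewise_image {κ : Type*} [DecidableEq κ] {x : κ → α} (hx : Function.Injective x)
    (S : Finset κ) (f g : α → A) (a : κ) :
    (S.image x).piecewise f g (x a) = S.piecewise (fun a => f (x a)) (fun a => g (x a)) a := by
  simp only [Finset.piecewise, hx.mem_finset_image]

theorem ladderFactor_image {κ : Type*} [LinearOrder κ] {x : κ → α} (hx : Function.Injective x)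
    (S U : Finset κ) (Q L R T : α → A) (a : κ) :
    ladderFactor (S.image x) (U.image x) Q L R T (x a) =
      ladderFactor S U (fun a => Q (x a)) (fun a => L (x a)) (fun a => R (x a))
        (fun a => T (x a)) a := by
  simp only [ladderFactor, Finset.piecewise, hx.mem_finset_image]

/-- Splitting off the smallest point `x`, which is in `S`, in `U`, in both or in neither. -/
theorem sum_smul_orderedProd_ladderFactor_insert [Semiring A] {k : Type*} [CommSemiring k]
    [Algebra k A]
    (Q L R T : α → A) {c c' d d' : Finset α → k} {x : α} {σ : Finset α} (hx : ∀ t ∈ σ, x < t)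
    (hc : ∀ S ⊆ σ, c (insert x S) = c' S) (hd : ∀ U ⊆ σ, d (insert x U) = d' U) :
    ∑ S ∈ (insert x σ).powerset, ∑ U ∈ (insert x σ).powerset,
        (c S * d U) • orderedProd (ladderFactor S U Q L R T) (insert x σ) =
      Q x * (∑ S ∈ σ.powerset, ∑ U ∈ σ.powerset,
        (c S * d U) • orderedProd (ladderFactor S U Q L R T) σ) +
      L x * (∑ S ∈ σ.powerset, ∑ U ∈ σ.powerset,
        (c' S * d U) • orderedProd (ladderFactor S U Q L R T) σ) +
      R x * (∑ S ∈ σ.powerset, ∑ U ∈ σ.powerset,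
        (c S * d' U) • orderedProd (ladderFactor S U Q L R T) σ) +
      T x * (∑ S ∈ σ.powerset, ∑ U ∈ σ.powerset,
        (c' S * d' U) • orderedProd (ladderFactor S U Q L R T) σ) := by
  have hxσ : x ∉ σ := fun h => lt_irrefl x (hx x h)
  have hxS : ∀ S ∈ σ.powerset, x ∉ S := fun S hS h => hxσ (Finset.mem_powerset.1 hS h)
  have hprod : ∀ S S' U U' : Finset α, (∀ t ∈ σ, t ∈ S' ↔ t ∈ S) → (∀ t ∈ σ, t ∈ U' ↔ t ∈ U) →
      orderedProd (ladderFactor S' U' Q L R T) (insert x σ) =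
        ladderFactor S' U' Q L R T x * orderedProd (ladderFactor S U Q L R T) σ := by
    intro S S' U U' hS hU
    rw [orderedProd_insert _ hx]
    congr 1
    exact orderedProd_congr fun t ht => by
      simp only [ladderFactor, Finset.piecewise, hS t ht, hU t ht]
  have hins : ∀ S : Finset α, ∀ t ∈ σ, t ∈ insert x S ↔ t ∈ S := fun S t ht => by
    simp [(hx t ht).ne']
  simp only [Finset.sum_powerset_insert hxσ, Finset.mul_sum, ← Finset.sum_add_distrib]
  refine Finset.sum_congr rfl fun S hS => Finset.sum_congr rfl fun U hU => ?_
  simp only [← hc S (Finset.mem_powerset.1 hS), ← hd U (Finset.mem_powerset.1 hU),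
    hprod S S U U (by simp) (by simp), hprod S S U (insert x U) (by simp) (hins U),
    hprod S (insert x S) U U (hins S) (by simp),
    hprod S (insert x S) U (insert x U) (hins S) (hins U), mul_smul_comm]
  have hS' := hxS S hS
  have hU' := hxS U hU
  simp only [ladderFactor, Finset.piecewise, hS', hU', Finset.mem_insert_self, if_true, if_false]
  abel

end OrderedProd

/-! ### The values of a wavefunction on configurations -/

/-- The value `√(n!) φₙ(t₁, …, tₙ)` of a wavefunction at the configuration `t₁ < ⋯ < tₙ`.  With this
normalisation the sum over `n` of the `L²` norms becomes a single integral over configurations,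
and annihilation at the leftmost point becomes its insertion. -/
def config (φ : Wave) (σ : Finset ℝ) : ℂ :=
  (Real.sqrt (σ.card.factorial) : ℂ) * φ σ.card (σ.orderEmbOfFin rfl)

theorem config_image_univ (φ : Wave) {n : ℕ} {x : Fin n → ℝ} (hx : StrictMono x) :
    config φ (Finset.univ.image x) = (Real.sqrt (n.factorial) : ℂ) * φ n x := by
  have hcard : (Finset.univ.image x).card = n := by
    rw [Finset.card_image_of_injective _ hx.injective, Finset.card_fin]
  have key : ∀ {σ : Finset ℝ}, σ.card = n → (∀ i, x i ∈ σ) →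
      config φ σ = (Real.sqrt (n.factorial) : ℂ) * φ n x := by
    rintro σ rfl hσ
    rw [config, Finset.orderEmbOfFin_unique rfl hσ hx]
  exact key hcard fun i => Finset.mem_image_of_mem x (Finset.mem_univ i)

@[simp]
theorem config_empty (φ : Wave) : config φ ∅ = φ 0 ![] := by
  simpa using config_image_univ φ (x := ![]) fun i => i.elim0

theorem config_insert (φ : Wave) {a : ℝ} {σ : Finset ℝ} (ha : ∀ b ∈ σ, a < b) :
    config φ (insert a σ) = config (annihilate a φ) σ := by
  have hmono : StrictMono (Fin.cons a (σ.orderEmbOfFin rfl) : Fin (σ.card + 1) → ℝ) :=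
    Fin.strictMono_cons.2
      ⟨fun i => ha _ (σ.orderEmbOfFin_mem rfl i), (σ.orderEmbOfFin rfl).strictMono⟩
  have himage : Finset.univ.image (Fin.cons a (σ.orderEmbOfFin rfl) : Fin (σ.card + 1) → ℝ) =
      insert a σ := by
    rw [← Finset.coe_inj, Finset.coe_image, Finset.coe_univ, Set.image_univ, Fin.range_cons,
      σ.range_orderEmbOfFin rfl, Finset.coe_insert]
  rw [← himage, config_image_univ φ hmono, config, annihilate, Nat.factorial_succ, Nat.cast_mul,
    Real.sqrt_mul (by positivity)]
  push_cast
  ring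

section Bond

variable {ι : Type} [Fintype ι]

theorem stateGenerator_map (Q L : ℝ → Matrix ι ι ℂ) (x : ℝ) (M : Matrix ι ι VecForm)
    (ψ : Wave) :
    (stateGenerator Q L x M).map (· ψ) =
      Q x * M.map (· ψ) + L x * M.map (· (annihilate x ψ)) := by
  ext i j
  simp [stateGenerator, bondTensor, Matrix.mul_apply, create]

theorem operatorGenerator_map (Q L R T : ℝ → Matrix ι ι ℂ) (x : ℝ) (M : Matrix ι ι OpForm)
    (ψ φ : Wave) :
    (operatorGenerator Q L R T x M).map (fun A => A ψ φ) =
      Q x * M.map (fun A => A ψ φ) + L x * M.map (fun A => A (annihilate x ψ) φ) +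
        R x * M.map (fun A => A ψ (annihilate x φ)) +
        T x * M.map (fun A => A (annihilate x ψ) (annihilate x φ)) := by
  ext i j
  simp [operatorGenerator, bondTensor, Matrix.mul_apply, leftMap, rightMap, adMap]

variable [DecidableEq ι]

theorem foldr_stateGenerator (Q L : ℝ → Matrix ι ι ℂ) (σ : Finset ℝ) (ψ : Wave) :
    ((σ.sort (· ≤ ·)).foldr (stateGenerator Q L) (Matrix.diagonal fun _ => vacuumVec)).map (· ψ) =
      ∑ S ∈ σ.powerset, conj (config ψ S) • orderedProd (S.piecewise L Q) σ := by
  induction σ using Finset.induction_on_min generalizing ψ with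
  | empty =>
    simp [vacuumVec, Matrix.diagonal_map, Matrix.smul_one_eq_diagonal]
  | insert a σ ha ih =>
    have haσ : a ∉ σ := fun h => lt_irrefl a (ha a h)
    rw [Finset.sort_insert _ (fun b hb => (ha b hb).le) haσ, List.foldr_cons, stateGenerator_map,
      ih, ih, Finset.sum_powerset_insert haσ, Finset.mul_sum, Finset.mul_sum]
    congr 1 <;> refine Finset.sum_congr rfl fun S hS => ?_ <;>
      have hSσ := Finset.mem_powerset.1 hS
    · rw [orderedProd_insert _ ha, S.piecewise_eq_of_notMem _ _ (fun h => haσ (hSσ h)),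
        mul_smul_comm]
    · rw [orderedProd_insert _ ha, Finset.piecewise_insert_self,
        orderedProd_piecewise_insert _ _ ha, config_insert ψ fun b hb => ha b (hSσ hb),
        mul_smul_comm]

theorem foldr_operatorGenerator (Q L R T : ℝ → Matrix ι ι ℂ) (σ : Finset ℝ) (ψ φ : Wave) :
    ((σ.sort (· ≤ ·)).foldr (operatorGenerator Q L R T)
        (Matrix.diagonal fun _ => vacuumProj)).map (fun A => A ψ φ) =
      ∑ S ∈ σ.powerset, ∑ U ∈ σ.powerset,
        (conj (config ψ S) * config φ U) • orderedProd (ladderFactor S U Q L R T) σ := by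
  induction σ using Finset.induction_on_min generalizing ψ φ with
  | empty =>
    simp [vacuumProj, Matrix.diagonal_map, Matrix.smul_one_eq_diagonal]
  | insert a σ ha ih =>
    have hinsert : ∀ χ : Wave, ∀ S ⊆ σ, config χ (insert a S) = config (annihilate a χ) S :=
      fun χ S hS => config_insert χ fun b hb => ha b (hS hb)
    rw [Finset.sort_insert _ (fun b hb => (ha b hb).le) fun h => lt_irrefl a (ha a h),
      List.foldr_cons, operatorGenerator_map, ih, ih, ih, ih,
      sum_smul_orderedProd_ladderFactor_insert Q L R T ha
        (c := fun S => conj (config ψ S)) (fun S hS => by rw [hinsert ψ S hS]) (hinsert φ)]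

theorem stateIntegrand_eq_sum (B : Matrix ι ι ℂ) (Q L : ℝ → Matrix ι ι ℂ) {m : ℕ} {x : Fin m → ℝ}
    (hx : StrictMono x) (ψ : Wave) :
    stateIntegrand B Q L m x ψ = ∑ S ∈ (Finset.univ.image x).powerset, conj (config ψ S) *
      (B * orderedProd (S.piecewise L Q) (Finset.univ.image x)).trace := by
  have htrace : stateIntegrand B Q L m x ψ = (B * (pathProduct (stateGenerator Q L)
      (Matrix.diagonal fun _ => vacuumVec) x).map (· ψ)).trace := by
    simp [stateIntegrand, bondTrace, Matrix.trace, Matrix.mul_apply]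
  rw [htrace, pathProduct, ← sort_image_univ hx, foldr_stateGenerator, Finset.mul_sum,
    Matrix.trace_sum]
  simp only [mul_smul_comm, Matrix.trace_smul, smul_eq_mul]

theorem operatorIntegrand_eq_sum (B : Matrix ι ι ℂ) (Q L R T : ℝ → Matrix ι ι ℂ) {m : ℕ}
    {x : Fin m → ℝ} (hx : StrictMono x) (ψ φ : Wave) :
    operatorIntegrand B Q L R T m x ψ φ =
      ∑ S ∈ (Finset.univ.image x).powerset, ∑ U ∈ (Finset.univ.image x).powerset,
        conj (config ψ S) * config φ U *
          (B * orderedProd (ladderFactor S U Q L R T) (Finset.univ.image x)).trace := by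
  have htrace : operatorIntegrand B Q L R T m x ψ φ = (B * (pathProduct
      (operatorGenerator Q L R T) (Matrix.diagonal fun _ => vacuumProj) x).map
        fun A => A ψ φ).trace := by
    simp [operatorIntegrand, bondTrace, Matrix.trace, Matrix.mul_apply]
  rw [htrace, pathProduct, ← sort_image_univ hx, foldr_operatorGenerator]
  simp only [Finset.mul_sum, Matrix.trace_sum, mul_smul_comm, Matrix.trace_smul, smul_eq_mul]

end Bond

/-! ### Ordered and unordered configurations -/

section Tuples

variable {X : Type*} [MeasurableSpace X] (μ : Measure X) [SigmaFinite μ] {m : ℕ}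

/-- Reordering the coordinates of a tuple. -/
def permEquiv (π : Equiv.Perm (Fin m)) : (Fin m → X) ≃ᵐ (Fin m → X) :=
  MeasurableEquiv.arrowCongr' π.symm (MeasurableEquiv.refl X)

@[simp] theorem permEquiv_apply (π : Equiv.Perm (Fin m)) (x : Fin m → X) :
    permEquiv π x = x ∘ π := rfl

theorem measurePreserving_permEquiv (π : Equiv.Perm (Fin m)) :
    MeasurePreserving (permEquiv π) (Measure.pi fun _ => μ) (Measure.pi fun _ => μ) :=
  measurePreserving_arrowCongr' _ _ _ _ fun _ => MeasurePreserving.id _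

theorem ae_injective [MeasurableEq X] [NullSingletonClass μ] :
    ∀ m : ℕ, ∀ᵐ x ∂(Measure.pi fun _ : Fin m => μ), Function.Injective x
  | 0 => .of_forall fun x => Function.injective_of_subsingleton x
  | m + 1 => by
    have hne : ∀ᵐ p ∂(μ.prod (Measure.pi fun _ : Fin m => μ)), ∀ k, p.2 k ≠ p.1 := by
      rw [ae_all_iff]
      intro k
      have hk : Measurable fun p : X × (Fin m → X) => p.2 k :=
        (measurable_pi_apply k).comp measurable_snd
      refine (Measure.ae_prod_iff_ae_ae (measurableSet_eq_fun hk measurable_fst).compl).2 ?_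
      exact .of_forall fun y => by simpa [ae_iff] using Measure.pi_hyperplane (fun _ => μ) k y
    have hinj := Measure.quasiMeasurePreserving_snd (μ := μ) |>.ae (ae_injective m)
    refine (measurePreserving_piFinSuccAbove (fun _ => μ) 0).quasiMeasurePreserving.ae
      (p := fun p => Function.Injective (Fin.cons p.1 p.2 : Fin (m + 1) → X)) ?_ |>.mono
      fun x hx => ?_
    · filter_upwards [hne, hinj] with p hp hp'
      exact Fin.cons_injective_iff.2 ⟨fun ⟨k, hk⟩ => hp k hk, hp'⟩
    · simpa [MeasurableEquiv.piFinSuccAbove, Fin.insertNthEquiv] using hx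

variable [LinearOrder X] [TopologicalSpace X] [OrderClosedTopology X] [SecondCountableTopology X]
  [OpensMeasurableSpace X]

theorem measurableSet_strictMono (m : ℕ) : MeasurableSet {x : Fin m → X | StrictMono x} := by
  simp only [StrictMono, Set.ofPred_forall]
  exact .iInter fun i => .iInter fun j => .iInter fun _ =>
    measurableSet_lt (measurable_pi_apply i) (measurable_pi_apply j)

variable [NullSingletonClass μ]

theorem pi_eq_sum_map_permEquiv (m : ℕ) :
    Measure.pi (fun _ : Fin m => μ) = Measure.sum fun π : Equiv.Perm (Fin m) =>
      ((Measure.pi fun _ => μ).restrict {x | StrictMono x}).map (permEquiv π) := by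
  have hmap : ∀ π : Equiv.Perm (Fin m),
      ((Measure.pi fun _ => μ).restrict {x | StrictMono x}).map (permEquiv π) =
        (Measure.pi fun _ => μ).restrict {x | StrictMono (x ∘ π.symm)} := fun π => by
    conv_rhs => rw [← (measurePreserving_permEquiv μ π).map_eq, (permEquiv π).restrict_map]
    simp [Set.preimage, Function.comp_assoc]
  simp only [hmap]
  rw [← Measure.restrict_iUnion]
  · refine (Measure.restrict_eq_self_of_ae_mem ?_).symm
    filter_upwards [ae_injective μ m] with x hx
    refine Set.mem_iUnion.2 ⟨(Tuple.sort x).symm, ?_⟩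
    exact (Tuple.monotone_sort x).strictMono_of_injective (hx.comp (Equiv.injective _))
  · intro π π' hne
    refine Set.disjoint_left.2 fun x hx hx' => hne ?_
    have hcomp : x ∘ π.symm = x ∘ π'.symm := by
      refine (StrictMono.range_inj hx hx').1 ?_
      rw [EquivLike.range_comp, EquivLike.range_comp]
    have hinj : Function.Injective x := (Equiv.injective_comp π.symm x).1 (StrictMono.injective hx)
    exact Equiv.symm_bijective.injective (DFunLike.coe_injective (hinj.comp_left hcomp))
  · exact fun π => (permEquiv π.symm).measurable (measurableSet_strictMono m)

variable {μ}

theorem ae_pi_of_forall_perm {p : (Fin m → X) → Prop}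
    (h : ∀ π : Equiv.Perm (Fin m),
      ∀ᵐ x ∂((Measure.pi fun _ => μ).restrict {x | StrictMono x}), p (x ∘ π)) :
    ∀ᵐ x ∂(Measure.pi fun _ => μ), p x := by
  rw [pi_eq_sum_map_permEquiv, Measure.ae_sum_iff]
  exact fun π => (permEquiv π).measurableEmbedding.ae_map_iff.2 (h π)

theorem aestronglyMeasurable_pi_of_forall_perm {E : Type*} [TopologicalSpace E]
    [TopologicalSpace.PseudoMetrizableSpace E] {F : (Fin m → X) → E}
    (h : ∀ π : Equiv.Perm (Fin m), AEStronglyMeasurable (fun x => F (x ∘ π))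
      ((Measure.pi fun _ => μ).restrict {x | StrictMono x})) :
    AEStronglyMeasurable F (Measure.pi fun _ => μ) := by
  rw [pi_eq_sum_map_permEquiv, aestronglyMeasurable_sum_measure_iff]
  exact fun π => (permEquiv π).measurableEmbedding.aestronglyMeasurable_map_iff.2 (h π)

theorem integral_pi_of_forall_perm {E : Type*} [NormedAddCommGroup E] [NormedSpace ℝ E]
    {F : (Fin m → X) → E} (hF : ∀ (π : Equiv.Perm (Fin m)) x, F (x ∘ π) = F x)
    (hi : Integrable F (Measure.pi fun _ => μ)) :
    ∫ x, F x ∂(Measure.pi fun _ => μ) =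
      m.factorial • ∫ x in {x | StrictMono x}, F x ∂(Measure.pi fun _ => μ) := by
  rw [pi_eq_sum_map_permEquiv] at hi
  conv_lhs => rw [pi_eq_sum_map_permEquiv]
  rw [integral_sum_measure hi]
  simp only [integral_map_equiv, permEquiv_apply, hF]
  rw [tsum_fintype, Finset.sum_const, Finset.card_univ, Fintype.card_perm, Fintype.card_fin]

end Tuples

/-! ### The measure on configurations -/

/-- Configurations of finitely many points, encoded as tuples in all possible orders. -/
abbrev Configuration (X : Type*) : Type _ := Σ m : ℕ, Fin m → X

/-- The set of points of a configuration. -/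
def Configuration.points {X : Type*} [DecidableEq X] (ω : Configuration X) : Finset X :=
  Finset.univ.image ω.2

/-- An `m`-tuple of points as a configuration. -/
abbrev tuple {X : Type*} (m : ℕ) : (Fin m → X) → Configuration X :=
  Sigma.mk (β := fun m => Fin m → X) m

theorem Configuration.points_comp_perm {X : Type*} [DecidableEq X] {m : ℕ} (x : Fin m → X)
    (π : Equiv.Perm (Fin m)) : (tuple m (x ∘ π)).points = (tuple m x).points := by
  simp only [points, ← Finset.image_image, Finset.image_univ_equiv]

section ConfigMeasure

variable {X : Type*} [MeasurableSpace X]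

theorem measurableEmbedding_tuple (m : ℕ) : MeasurableEmbedding (tuple (X := X) m) where
  injective := sigma_mk_injective
  measurable := fun s hs => MeasurableSpace.measurableSet_iInf.1 hs m
  measurableSet_image' := fun s hs => by
    refine MeasurableSpace.measurableSet_iInf.2 fun k => ?_
    change MeasurableSet (tuple k ⁻¹' (tuple m '' s))
    rcases eq_or_ne m k with rfl | hne
    · rwa [Set.preimage_image_eq _ sigma_mk_injective]
    · rw [Set.preimage_image_sigmaMk_of_ne hne.symm]
      exact .empty

/-- The measure on configurations which on `m`-tuples is the product measure divided by `m!`, so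
that every set of `m` points is counted once. -/
def configMeasure (μ : Measure X) : Measure (Configuration X) :=
  Measure.sum fun m => (m.factorial : ENNReal)⁻¹ • (Measure.pi fun _ => μ).map (tuple m)

variable {μ : Measure X}

instance [SigmaFinite μ] : SFinite (configMeasure μ) := by
  unfold configMeasure
  infer_instance

theorem inv_factorial_ne_zero (m : ℕ) : (m.factorial : ENNReal)⁻¹ ≠ 0 := by simp

theorem inv_factorial_ne_top (m : ℕ) : (m.factorial : ENNReal)⁻¹ ≠ ⊤ := by
  simp [m.factorial_ne_zero]

theorem lintegral_configMeasure (f : Configuration X → ENNReal) :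
    ∫⁻ ω, f ω ∂(configMeasure μ) =
      ∑' m : ℕ, (m.factorial : ENNReal)⁻¹ * ∫⁻ x, f ⟨m, x⟩ ∂(Measure.pi fun _ => μ) := by
  simp only [configMeasure, lintegral_sum_measure, lintegral_smul_measure,
    (measurableEmbedding_tuple _).lintegral_map, smul_eq_mul]

theorem ae_configMeasure {p : Configuration X → Prop} :
    (∀ᵐ ω ∂(configMeasure μ), p ω) ↔ ∀ m, ∀ᵐ x ∂(Measure.pi fun _ => μ), p ⟨m, x⟩ := by
  simp only [configMeasure, Measure.ae_sum_iff,
    Measure.ae_ennreal_smul_measure_iff (inv_factorial_ne_zero _),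
    (measurableEmbedding_tuple _).ae_map_iff]

theorem aestronglyMeasurable_configMeasure_iff {E : Type*} [TopologicalSpace E]
    [TopologicalSpace.PseudoMetrizableSpace E] {f : Configuration X → E} :
    AEStronglyMeasurable f (configMeasure μ) ↔
      ∀ m, AEStronglyMeasurable (fun x => f ⟨m, x⟩) (Measure.pi fun _ => μ) := by
  rw [configMeasure, aestronglyMeasurable_sum_measure_iff]
  refine forall_congr' fun m => ?_
  rw [← Function.comp_def, ← (measurableEmbedding_tuple m).aestronglyMeasurable_map_iff]
  exact ⟨fun h => h.mono_ac (Measure.absolutelyContinuous_smul (inv_factorial_ne_zero m)),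
    fun h => h.smul_measure _⟩

variable {E : Type*} [NormedAddCommGroup E]

theorem integrable_configMeasure_iff {f : Configuration X → E} :
    Integrable f (configMeasure μ) ↔
      (∀ m, Integrable (fun x => f ⟨m, x⟩) (Measure.pi fun _ => μ)) ∧
        Summable fun m : ℕ =>
          (m.factorial : ℝ)⁻¹ * ∫ x, ‖f ⟨m, x⟩‖ ∂(Measure.pi fun _ => μ) := by
  rw [configMeasure, integrable_sum_measure_iff]
  simp only [integrable_smul_measure (inv_factorial_ne_zero _) (inv_factorial_ne_top _),
    (measurableEmbedding_tuple _).integrable_map_iff, integral_smul_measure,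
    (measurableEmbedding_tuple _).integral_map, ENNReal.toReal_inv, ENNReal.toReal_natCast,
    smul_eq_mul, Function.comp_def]

theorem hasSum_integral_configMeasure [NormedSpace ℝ E] {f : Configuration X → E}
    (hf : Integrable f (configMeasure μ)) :
    HasSum (fun m : ℕ => (m.factorial : ℝ)⁻¹ • ∫ x, f ⟨m, x⟩ ∂(Measure.pi fun _ => μ))
      (∫ ω, f ω ∂(configMeasure μ)) := by
  refine (hasSum_integral_measure hf).congr_fun fun m => ?_
  rw [integral_smul_measure, (measurableEmbedding_tuple m).integral_map]
  simp

end ConfigMeasure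

theorem hasDysonSum_of_integrable {I : Set ℝ} {f : Finset ℝ → ℂ}
    (hf : Integrable (fun ω => f ω.points) (configMeasure (volume.restrict I))) :
    HasDysonSum I (fun _ x => f (Finset.univ.image x))
      (∫ ω, f ω.points ∂(configMeasure (volume.restrict I))) := by
  have hi := (integrable_configMeasure_iff.1 hf).1
  refine ⟨fun m => (hi m).mono_measure Measure.restrict_le_self, ?_⟩
  refine (hasSum_integral_configMeasure hf).congr_fun fun m => ?_
  rw [integral_pi_of_forall_perm (fun π x => congrArg f (Configuration.points_comp_perm x π))
    (hi m), ← Nat.cast_smul_eq_nsmul ℝ, inv_smul_smul₀ (by exact_mod_cast m.factorial_ne_zero)]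
  rfl

/-! ### The sum-integral formula -/

section Split

variable {X : Type*} {m : ℕ}

theorem points_comp_orderEmbOfFin [DecidableEq X] (S : Finset (Fin m)) (x : Fin m → X) :
    (tuple S.card (x ∘ S.orderEmbOfFin rfl)).points = S.image x := by
  simp only [Configuration.points]
  rw [← Finset.image_image, Finset.image_orderEmbOfFin_univ]

/-- The parts of a configuration with indices in `S` and outside `S`. -/
def splitConfig (S : Finset (Fin m)) (x : Fin m → X) : Configuration X × Configuration X :=
  (⟨S.card, x ∘ S.orderEmbOfFin rfl⟩, ⟨Sᶜ.card, x ∘ Sᶜ.orderEmbOfFin rfl⟩)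

theorem splitConfig_fst_points [DecidableEq X] (S : Finset (Fin m)) (x : Fin m → X) :
    (splitConfig S x).1.points = S.image x := points_comp_orderEmbOfFin S x

theorem splitConfig_snd_points [DecidableEq X] (S : Finset (Fin m)) (x : Fin m → X) :
    (splitConfig S x).2.points = Sᶜ.image x := points_comp_orderEmbOfFin Sᶜ x

theorem sum_powerset_points [DecidableEq X] {x : Fin m → X} (hx : Function.Injective x)
    {M : Type*} [AddCommMonoid M] (g : Finset X → Finset X → M) :
    ∑ S ∈ (tuple m x).points.powerset, g S ((tuple m x).points \ S) =
      ∑ S : Finset (Fin m), g (S.image x) (Sᶜ.image x) := by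
  simp only [Configuration.points]
  rw [Finset.powerset_image, Finset.sum_image (Finset.image_injective hx).injOn,
    Finset.powerset_univ]
  refine Finset.sum_congr rfl fun S _ => ?_
  rw [← Finset.image_sdiff _ _ hx, Finset.compl_eq_univ_sdiff]

theorem sum_finset_fin_inv_factorial_mul (m : ℕ) (a : ℕ → ℕ → ENNReal) :
    ∑ S : Finset (Fin m), (m.factorial : ENNReal)⁻¹ * a S.card Sᶜ.card =
      ∑ q ∈ Finset.HasAntidiagonal.antidiagonal m,
        (q.2.factorial : ENNReal)⁻¹ * ((q.1.factorial : ENNReal)⁻¹ * a q.1 q.2) := by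
  have h := Finset.sum_powerset_apply_card
    (fun n => (m.factorial : ENNReal)⁻¹ * a n (m - n)) (x := (Finset.univ : Finset (Fin m)))
  rw [Finset.powerset_univ, Finset.card_fin] at h
  simp only [Finset.card_compl, Fintype.card_fin]
  rw [h, Finset.Nat.sum_antidiagonal_eq_sum_range_succ_mk]
  refine Finset.sum_congr rfl fun n hn => ?_
  have hn' : n ≤ m := Nat.lt_succ_iff.1 (Finset.mem_range.1 hn)
  have hchoose : ((m.choose n : ℕ) : ENNReal) ≠ 0 := by exact_mod_cast (Nat.choose_pos hn').ne'
  rw [← Nat.choose_mul_factorial_mul_factorial hn', nsmul_eq_mul]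
  push_cast
  rw [ENNReal.mul_inv (.inr (ENNReal.natCast_ne_top _))
    (.inr (by exact_mod_cast (m - n).factorial_ne_zero)),
    ENNReal.mul_inv (.inl hchoose) (.inl (ENNReal.natCast_ne_top _)), ← mul_assoc, ← mul_assoc,
    ← mul_assoc, ENNReal.mul_inv_cancel hchoose (ENNReal.natCast_ne_top _), one_mul, ← mul_assoc,
    mul_comm (n.factorial : ENNReal)⁻¹]

theorem tsum_sum_finset_fin_inv_factorial_mul (a : ℕ → ℕ → ENNReal) :
    ∑' m : ℕ, ∑ S : Finset (Fin m), (m.factorial : ENNReal)⁻¹ * a S.card Sᶜ.card =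
      ∑' p : ℕ × ℕ, (p.2.factorial : ENNReal)⁻¹ * ((p.1.factorial : ENNReal)⁻¹ * a p.1 p.2) := by
  rw [← Finset.HasAntidiagonal.sigmaAntidiagonalEquivProd.tsum_eq, ENNReal.tsum_sigma']
  refine tsum_congr fun m => ?_
  rw [sum_finset_fin_inv_factorial_mul]
  exact (Finset.tsum_subtype _ fun q : ℕ × ℕ =>
    (q.2.factorial : ENNReal)⁻¹ * ((q.1.factorial : ENNReal)⁻¹ * a q.1 q.2)).symm

variable [MeasurableSpace X]

/-- Splitting the coordinates of a tuple. -/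
def splitEquiv (S : Finset (Fin m)) : (Fin m → X) ≃ᵐ (Fin S.card → X) × (Fin Sᶜ.card → X) :=
  (MeasurableEquiv.arrowCongr' (finSumEquivOfFinset rfl rfl).symm (MeasurableEquiv.refl X)).trans
    (MeasurableEquiv.sumPiEquivProdPi fun _ => X)

theorem splitConfig_eq (S : Finset (Fin m)) :
    splitConfig (X := X) S = Prod.map (tuple S.card) (tuple Sᶜ.card) ∘ splitEquiv S := rfl

theorem measurableEmbedding_splitConfig (S : Finset (Fin m)) :
    MeasurableEmbedding (splitConfig (X := X) S) := by
  rw [splitConfig_eq]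
  exact ((measurableEmbedding_tuple _).prodMap (measurableEmbedding_tuple _)).comp
    (splitEquiv S).measurableEmbedding

variable (μ : Measure X) [SigmaFinite μ]

theorem measurePreserving_splitEquiv (S : Finset (Fin m)) :
    MeasurePreserving (splitEquiv S) (Measure.pi fun _ => μ)
      ((Measure.pi fun _ : Fin S.card => μ).prod (Measure.pi fun _ : Fin Sᶜ.card => μ)) :=
  (measurePreserving_arrowCongr' _ _ _ _ fun _ => MeasurePreserving.id _).trans
    (measurePreserving_sumPiEquivProdPi fun _ => μ)

theorem map_splitConfig_pi (S : Finset (Fin m)) :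
    (Measure.pi fun _ => μ).map (splitConfig S) =
      ((Measure.pi fun _ : Fin S.card => μ).prod (Measure.pi fun _ : Fin Sᶜ.card => μ)).map
        (Prod.map (tuple S.card) (tuple Sᶜ.card)) := by
  rw [← (measurePreserving_splitEquiv μ S).map_eq, Measure.map_map _ (splitEquiv _).measurable,
    ← splitConfig_eq]
  exact ((measurableEmbedding_tuple _).prodMap (measurableEmbedding_tuple _)).measurable

/-- A pair of independent configurations is a configuration together with a splitting into
two parts: the binomial coefficient counting the splittings turns `1 / m!` into
`1 / n! * 1 / (m - n)!`. -/
theorem configMeasure_prod :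
    (configMeasure μ).prod (configMeasure μ) =
      Measure.sum fun p : (Σ m : ℕ, Finset (Fin m)) =>
        (p.1.factorial : ENNReal)⁻¹ • (Measure.pi fun _ => μ).map (splitConfig p.2) := by
  simp only [map_splitConfig_pi]
  rw [configMeasure, Measure.prod_sum]
  ext s hs
  rw [Measure.sum_apply _ hs, Measure.sum_apply _ hs, ENNReal.tsum_sigma']
  simp only [Measure.prod_smul_left, Measure.prod_smul_right,
    Measure.map_prod_map _ _ (measurableEmbedding_tuple _).measurable
      (measurableEmbedding_tuple _).measurable, Measure.smul_apply, smul_eq_mul, tsum_fintype]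
  exact (tsum_sum_finset_fin_inv_factorial_mul fun n k =>
    (((Measure.pi fun _ : Fin n => μ).prod (Measure.pi fun _ : Fin k => μ)).map
      (Prod.map (tuple n) (tuple k))) s).symm

variable {μ} [DecidableEq X]

theorem ae_forall_mem_powerset_points {p : Finset X → Prop}
    (h : ∀ᵐ ω ∂(configMeasure μ), p ω.points) (m : ℕ) :
    ∀ᵐ x : Fin m → X ∂(Measure.pi fun _ => μ), ∀ S ∈ (tuple m x).points.powerset, p S := by
  have hsub : ∀ᵐ x : Fin m → X ∂(Measure.pi fun _ => μ), ∀ S : Finset (Fin m), p (S.image x) :=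
    ae_all_iff.2 fun S => by
      have h' := (Measure.quasiMeasurePreserving_fst.comp
        (measurePreserving_splitEquiv μ S).quasiMeasurePreserving).ae (ae_configMeasure.1 h S.card)
      refine h'.mono fun x hx => ?_
      rw [← points_comp_orderEmbOfFin]
      exact hx
  refine hsub.mono fun x hx S hS => ?_
  rw [Configuration.points, Finset.powerset_image] at hS
  obtain ⟨V, -, rfl⟩ := Finset.mem_image.1 hS
  exact hx V

theorem aestronglyMeasurable_image_image_compl {E : Type*} [TopologicalSpace E]
    [TopologicalSpace.PseudoMetrizableSpace E] {G : Finset X → Finset X → E}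
    (hG : AEStronglyMeasurable (fun p => G p.1.points p.2.points)
      ((configMeasure μ).prod (configMeasure μ))) (S : Finset (Fin m)) :
    AEStronglyMeasurable (fun x => G (S.image x) (Sᶜ.image x)) (Measure.pi fun _ => μ) := by
  rw [configMeasure_prod, aestronglyMeasurable_sum_measure_iff] at hG
  have h := (measurableEmbedding_splitConfig S).aestronglyMeasurable_map_iff.1
    ((hG ⟨m, S⟩).mono_ac (Measure.absolutelyContinuous_smul (inv_factorial_ne_zero m)))
  simpa only [Function.comp_def, splitConfig_fst_points, splitConfig_snd_points] using h

variable {E : Type*} [NormedAddCommGroup E] {G : Finset X → Finset X → E}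

theorem integrable_image_image_compl
    (hG : Integrable (fun p => G p.1.points p.2.points)
      ((configMeasure μ).prod (configMeasure μ))) (S : Finset (Fin m)) :
    Integrable (fun x => G (S.image x) (Sᶜ.image x)) (Measure.pi fun _ => μ) := by
  rw [configMeasure_prod] at hG
  have h := (integrable_sum_measure_iff.1 hG).1 ⟨m, S⟩
  rw [integrable_smul_measure (inv_factorial_ne_zero m) (inv_factorial_ne_top m),
    (measurableEmbedding_splitConfig S).integrable_map_iff] at h
  simpa only [Function.comp_def, splitConfig_fst_points, splitConfig_snd_points] using h

variable [MeasurableEq X] [NullSingletonClass μ]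

theorem sum_powerset_points_ae {M : Type*} [AddCommMonoid M] (g : Finset X → Finset X → M)
    (m : ℕ) :
    (fun x : Fin m → X => ∑ S ∈ (tuple m x).points.powerset, g S ((tuple m x).points \ S))
      =ᵐ[Measure.pi fun _ => μ] fun x => ∑ S : Finset (Fin m), g (S.image x) (Sᶜ.image x) :=
  (ae_injective μ m).mono fun _ hx => sum_powerset_points hx g

theorem lintegral_sum_powerset_enorm
    (hG : AEStronglyMeasurable (fun p => G p.1.points p.2.points)
      ((configMeasure μ).prod (configMeasure μ))) :
    ∫⁻ ω, ∑ S ∈ ω.points.powerset, ‖G S (ω.points \ S)‖ₑ ∂(configMeasure μ) =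
      ∫⁻ p, ‖G p.1.points p.2.points‖ₑ ∂((configMeasure μ).prod (configMeasure μ)) := by
  rw [lintegral_configMeasure, configMeasure_prod, lintegral_sum_measure, ENNReal.tsum_sigma']
  refine tsum_congr fun m => ?_
  simp only [lintegral_smul_measure, (measurableEmbedding_splitConfig _).lintegral_map,
    splitConfig_fst_points, splitConfig_snd_points, smul_eq_mul, tsum_fintype]
  rw [← Finset.mul_sum, ← lintegral_finsetSum' _ fun S _ =>
    (aestronglyMeasurable_image_image_compl hG S).enorm]
  exact congrArg _ (lintegral_congr_ae (sum_powerset_points_ae (fun S S' => ‖G S S'‖ₑ) m))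

theorem integrable_sum_powerset
    (hG : Integrable (fun p => G p.1.points p.2.points)
      ((configMeasure μ).prod (configMeasure μ))) :
    Integrable (fun ω => ∑ S ∈ ω.points.powerset, G S (ω.points \ S)) (configMeasure μ) := by
  refine ⟨aestronglyMeasurable_configMeasure_iff.2 fun m => ?_, ?_⟩
  · exact ((integrable_finsetSum _ fun S _ =>
      integrable_image_image_compl hG S).aestronglyMeasurable).congr
      (sum_powerset_points_ae G m).symm
  · refine (lintegral_mono fun ω => ?_).trans_lt
      ((lintegral_sum_powerset_enorm hG.aestronglyMeasurable).trans_lt hG.hasFiniteIntegral)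
    exact enorm_sum_le _ _

theorem integrable_of_sum_powerset_norm_le {F : Finset X → Finset X → ℝ}
    (hG : AEStronglyMeasurable (fun p => G p.1.points p.2.points)
      ((configMeasure μ).prod (configMeasure μ)))
    (hF : Integrable (fun p => F p.1.points p.2.points)
      ((configMeasure μ).prod (configMeasure μ)))
    (h : ∀ ρ, ∑ S ∈ ρ.powerset, ‖G S (ρ \ S)‖ ≤ ∑ S ∈ ρ.powerset, F S (ρ \ S)) :
    Integrable (fun p => G p.1.points p.2.points)
      ((configMeasure μ).prod (configMeasure μ)) := by
  refine ⟨hG, ?_⟩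
  rw [HasFiniteIntegral, ← lintegral_sum_powerset_enorm hG]
  refine (lintegral_mono fun ω => ?_).trans_lt
    ((lintegral_sum_powerset_enorm hF.aestronglyMeasurable).trans_lt hF.hasFiniteIntegral)
  simp only [← ofReal_norm]
  rw [← ENNReal.ofReal_sum_of_nonneg fun _ _ => norm_nonneg _,
    ← ENNReal.ofReal_sum_of_nonneg fun _ _ => norm_nonneg _]
  exact ENNReal.ofReal_le_ofReal
    ((h ω.points).trans (Finset.sum_le_sum fun S _ => Real.le_norm_self _))

variable [NormedSpace ℝ E]

theorem integral_sum_powerset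
    (hG : Integrable (fun p => G p.1.points p.2.points)
      ((configMeasure μ).prod (configMeasure μ))) :
    ∫ ω, ∑ S ∈ ω.points.powerset, G S (ω.points \ S) ∂(configMeasure μ) =
      ∫ p, G p.1.points p.2.points ∂((configMeasure μ).prod (configMeasure μ)) := by
  have hG' := hG
  rw [configMeasure_prod] at hG'
  have hsum := hasSum_integral_measure hG'
  rw [← configMeasure_prod] at hsum
  refine (hasSum_integral_configMeasure (integrable_sum_powerset hG)).unique
    ((hsum.sigma fun m => hasSum_fintype _).congr_fun fun m => ?_)
  simp only [integral_smul_measure, (measurableEmbedding_splitConfig _).integral_map,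
    splitConfig_fst_points, splitConfig_snd_points]
  rw [← Finset.smul_sum, ← integral_finsetSum _ fun S _ => integrable_image_image_compl hG S,
    integral_congr_ae (sum_powerset_points_ae G m)]
  simp

end Split

theorem hasDysonSum_sum_powerset {I : Set ℝ} {G : Finset ℝ → Finset ℝ → ℂ}
    (hG : Integrable (fun p => G p.1.points p.2.points)
      ((configMeasure (volume.restrict I)).prod (configMeasure (volume.restrict I)))) :
    HasDysonSum I (fun _ x => ∑ S ∈ (Finset.univ.image x).powerset, G S (Finset.univ.image x \ S))
      (∫ p, G p.1.points p.2.points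
        ∂((configMeasure (volume.restrict I)).prod (configMeasure (volume.restrict I)))) := by
  rw [← integral_sum_powerset hG]
  exact hasDysonSum_of_integrable (f := fun σ => ∑ S ∈ σ.powerset, G S (σ \ S))
    (integrable_sum_powerset hG)

theorem aestronglyMeasurable_prod_points {X : Type*} [LinearOrder X] [TopologicalSpace X]
    [OrderClosedTopology X] [SecondCountableTopology X] [MeasurableSpace X]
    [OpensMeasurableSpace X] {μ : Measure X} [SigmaFinite μ] [NullSingletonClass μ] {E : Type*}
    [TopologicalSpace E] [TopologicalSpace.PseudoMetrizableSpace E] {G : Finset X → Finset X → E}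
    (h : ∀ (m : ℕ) (S : Finset (Fin m)), AEStronglyMeasurable
      (fun x => G (S.image x) (Sᶜ.image x)) ((Measure.pi fun _ => μ).restrict {x | StrictMono x})) :
    AEStronglyMeasurable (fun p : Configuration X × Configuration X => G p.1.points p.2.points)
      ((configMeasure μ).prod (configMeasure μ)) := by
  rw [configMeasure_prod, aestronglyMeasurable_sum_measure_iff]
  rintro ⟨m, S⟩
  refine AEStronglyMeasurable.smul_measure
    ((measurableEmbedding_splitConfig S).aestronglyMeasurable_map_iff.2 ?_) _
  simp only [Function.comp_def, splitConfig_fst_points, splitConfig_snd_points]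
  refine aestronglyMeasurable_pi_of_forall_perm fun π => ?_
  convert h m (S.image π) using 2 with x
  have hcompl : (S.image π)ᶜ = Sᶜ.image π := Finset.coe_injective (by
    simpa only [Finset.coe_compl, Finset.coe_image] using Set.image_compl_eq π.bijective |>.symm)
  rw [hcompl, Finset.image_image, Finset.image_image]

/-! ### Fock vectors as functions on configurations -/

section ProdPoints

variable {X : Type*} [MeasurableSpace X] [MeasurableEq X] [DecidableEq X] {μ : Measure X}
  [SigmaFinite μ] [NullSingletonClass μ]

theorem prod_points_ae {R : Type*} [CommMonoid R] (f : X → R) (m : ℕ) :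
    (fun x : Fin m → X => ∏ t ∈ (tuple m x).points, f t) =ᵐ[Measure.pi fun _ => μ]
      fun x => ∏ i, f (x i) := by
  filter_upwards [ae_injective μ m] with x hx
  exact Finset.prod_image hx.injOn

theorem integrable_prod_points {f : X → ℝ} (hf : Integrable f μ) :
    Integrable (fun ω => ∏ t ∈ ω.points, f t) (configMeasure μ) := by
  refine integrable_configMeasure_iff.2 ⟨fun m => ?_, ?_⟩
  · exact (Integrable.fintype_prod fun _ => hf).congr (prod_points_ae f m).symm
  · have hpow : ∀ m : ℕ, ∫ x, ‖∏ t ∈ (tuple m x).points, f t‖ ∂(Measure.pi fun _ => μ) =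
        (∫ t, ‖f t‖ ∂μ) ^ m := fun m => by
      refine (integral_congr_ae ((prod_points_ae f m).fun_comp norm)).trans ?_
      simp only [Function.comp_apply, norm_prod]
      rw [integral_fintype_prod_eq_prod (𝕜 := ℝ) (fun _ t => ‖f t‖), Finset.prod_const,
        Finset.card_fin]
    simpa only [hpow, div_eq_inv_mul] using Real.summable_pow_div_factorial (∫ t, ‖f t‖ ∂μ)

theorem memLp_prod_points {f : X → ℝ} (hf : MemLp f 2 μ) :
    MemLp (fun ω => ∏ t ∈ ω.points, f t) 2 (configMeasure μ) := by
  rw [memLp_two_iff_integrable_sq]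
  · simpa only [← Finset.prod_pow] using integrable_prod_points hf.integrable_sq
  · refine aestronglyMeasurable_configMeasure_iff.2 fun m => ?_
    refine AEStronglyMeasurable.congr ?_ (prod_points_ae f m).symm
    exact Finset.aestronglyMeasurable_fun_prod _ fun i _ =>
      hf.1.comp_quasiMeasurePreserving (Measure.quasiMeasurePreserving_eval _ i)

end ProdPoints

theorem L2_norm_sq_eq_integral {X E : Type*} [MeasurableSpace X] {μ : Measure X}
    [NormedAddCommGroup E] [InnerProductSpace ℂ E] (f : Lp E 2 μ) :
    ‖f‖ ^ 2 = ∫ x, ‖f x‖ ^ 2 ∂μ := by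
  rw [← inner_self_eq_norm_sq (𝕜 := ℂ), L2.inner_def, ← integral_re (L2.integrable_inner f f)]
  simp only [inner_self_eq_norm_sq]

theorem ofReal_sqrt_factorial_ne_zero (n : ℕ) : (Real.sqrt (n.factorial) : ℂ) ≠ 0 := by
  exact_mod_cast (Real.sqrt_pos.2 (by positivity)).ne'

theorem norm_ofReal_sqrt_factorial_sq (n : ℕ) :
    ‖(Real.sqrt (n.factorial) : ℂ)‖ ^ 2 = n.factorial := by
  rw [Complex.norm_real, Real.norm_of_nonneg (Real.sqrt_nonneg _), Real.sq_sqrt (by positivity)]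

section Vectors

variable {I : Set ℝ}

theorem ae_strictMono (I : Set ℝ) (m : ℕ) : ∀ᵐ x ∂(orderedMeasure I m), StrictMono x :=
  ae_restrict_mem (measurableSet_strictMono m)

theorem config_wave_ae (Ψ : Fock I) (n : ℕ) :
    ∀ᵐ x ∂(cubeMeasure I n), config (wave Ψ) (tuple n x).points =
      (Real.sqrt (n.factorial) : ℂ) * wave Ψ n x := by
  refine ae_pi_of_forall_perm fun π => ?_
  filter_upwards [ae_strictMono I n, ae_restrict_of_ae ((Ψ n).2 π)] with x hx hπ
  rw [Configuration.points_comp_perm, Configuration.points, config_image_univ _ hx]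
  exact congrArg _ hπ.symm

theorem norm_config_wave_sq_ae (Ψ : Fock I) (n : ℕ) :
    (fun x => ‖config (wave Ψ) (tuple n x).points‖ ^ 2) =ᵐ[cubeMeasure I n]
      fun x => n.factorial * ‖wave Ψ n x‖ ^ 2 := by
  filter_upwards [config_wave_ae Ψ n] with x hx
  rw [hx, norm_mul, mul_pow, norm_ofReal_sqrt_factorial_sq]

theorem memLp_config (Ψ : Fock I) :
    MemLp (fun ω => config (wave Ψ) ω.points) 2 (configMeasure (volume.restrict I)) := by
  have hwave : ∀ n, MemLp (wave Ψ n) 2 (cubeMeasure I n) := fun n => Lp.memLp _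
  rw [memLp_two_iff_integrable_sq_norm]
  · refine integrable_configMeasure_iff.2 ⟨fun n => ?_, ?_⟩
    · exact (((memLp_two_iff_integrable_sq_norm (hwave n).1).1 (hwave n)).const_mul _).congr
        (norm_config_wave_sq_ae Ψ n).symm
    · have hnorm : ∀ n : ℕ, (n.factorial : ℝ)⁻¹ *
          ∫ x, ‖‖config (wave Ψ) (tuple n x).points‖ ^ 2‖ ∂(cubeMeasure I n) = ‖Ψ n‖ ^ 2 := by
        intro n
        simp only [norm_pow, norm_norm]
        rw [integral_congr_ae (norm_config_wave_sq_ae Ψ n), integral_const_mul,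
          inv_mul_cancel_left₀ (by exact_mod_cast n.factorial_ne_zero)]
        exact (L2_norm_sq_eq_integral _).symm
      simp only [hnorm]
      simpa using (lp.memℓp Ψ).summable (by norm_num)
  · exact aestronglyMeasurable_configMeasure_iff.2 fun n =>
      ((hwave n).1.const_mul _).congr (Filter.EventuallyEq.symm (config_wave_ae Ψ n))

variable {F : Finset ℝ → ℂ}

theorem memLp_component
    (hF : MemLp (fun ω : Configuration ℝ => F ω.points) 2 (configMeasure (volume.restrict I)))
    (n : ℕ) :
    MemLp (fun x => (Real.sqrt (n.factorial) : ℂ)⁻¹ * F (tuple n x).points) 2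
      (cubeMeasure I n) := by
  refine MemLp.const_mul ((memLp_two_iff_integrable_sq_norm ?_).2 ?_) _
  · exact aestronglyMeasurable_configMeasure_iff.1 hF.1 n
  · exact (integrable_configMeasure_iff.1 ((memLp_two_iff_integrable_sq_norm hF.1).1 hF)).1 n

/-- The `n`-particle component of the Fock vector with values `F` on configurations. -/
def component
    (hF : MemLp (fun ω : Configuration ℝ => F ω.points) 2 (configMeasure (volume.restrict I)))
    (n : ℕ) : sector I n :=
  ⟨(memLp_component hF n).toLp _, fun π => by
    have h := (memLp_component hF n).coeFn_toLp
    refine ((quasiMeasurePreserving_comp I π π.injective).ae_eq_comp h).trans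
      (Filter.EventuallyEq.trans (.of_forall fun x => ?_) h.symm)
    exact congrArg (fun σ => _ * F σ) (Configuration.points_comp_perm x π)⟩

theorem component_ae
    (hF : MemLp (fun ω : Configuration ℝ => F ω.points) 2 (configMeasure (volume.restrict I)))
    (n : ℕ) : (component hF n : Lp ℂ 2 (cubeMeasure I n)) =ᵐ[cubeMeasure I n]
      fun x => (Real.sqrt (n.factorial) : ℂ)⁻¹ * F (tuple n x).points :=
  (memLp_component hF n).coeFn_toLp

theorem memℓp_component
    (hF : MemLp (fun ω : Configuration ℝ => F ω.points) 2 (configMeasure (volume.restrict I))) :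
    Memℓp (component hF) 2 := by
  have hnorm : ∀ n : ℕ, ‖component hF n‖ ^ 2 =
      (n.factorial : ℝ)⁻¹ * ∫ x, ‖F (tuple n x).points‖ ^ 2 ∂(cubeMeasure I n) := fun n => by
    refine (L2_norm_sq_eq_integral (component hF n : Lp ℂ 2 (cubeMeasure I n))).trans ?_
    rw [← integral_const_mul]
    refine integral_congr_ae ?_
    filter_upwards [component_ae hF n] with x hx
    rw [hx, norm_mul, mul_pow, norm_inv, inv_pow, norm_ofReal_sqrt_factorial_sq]
  refine memℓp_gen ?_
  simp only [ENNReal.toReal_ofNat, Real.rpow_ofNat, hnorm]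
  simpa only [norm_pow, norm_norm] using
    (integrable_configMeasure_iff.1 ((memLp_two_iff_integrable_sq_norm hF.1).1 hF)).2

/-- The Fock vector with values `F` on configurations. -/
def ofConfig
    (hF : MemLp (fun ω : Configuration ℝ => F ω.points) 2 (configMeasure (volume.restrict I))) :
    Fock I :=
  ⟨component hF, memℓp_component hF⟩

theorem config_ofConfig_ae
    (hF : MemLp (fun ω : Configuration ℝ => F ω.points) 2 (configMeasure (volume.restrict I))) :
    ∀ᵐ ω ∂(configMeasure (volume.restrict I)),
      config (wave (ofConfig hF)) ω.points = F ω.points := by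
  refine ae_configMeasure.2 fun n => ?_
  filter_upwards [config_wave_ae (ofConfig hF) n, component_ae hF n] with x hx hx'
  rw [hx]
  refine (congrArg _ hx').trans ?_
  rw [mul_inv_cancel_left₀ (ofReal_sqrt_factorial_ne_zero n)]

theorem inner_eq_integral_config (Ψ Φ : Fock I) :
    inner ℂ Ψ Φ = ∫ ω, conj (config (wave Ψ) ω.points) * config (wave Φ) ω.points
      ∂(configMeasure (volume.restrict I)) := by
  refine (lp.hasSum_inner Ψ Φ).unique ?_
  have hi : Integrable (fun ω => conj (config (wave Ψ) ω.points) * config (wave Φ) ω.points)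
      (configMeasure (volume.restrict I)) :=
    (memLp_config Ψ).star.integrable_mul (memLp_config Φ)
  refine (hasSum_integral_configMeasure hi).congr_fun fun n => ?_
  refine (L2.inner_def (𝕜 := ℂ) (Ψ n : Lp ℂ 2 (cubeMeasure I n)) (Φ n)).trans ?_
  rw [← integral_smul]
  refine integral_congr_ae ?_
  filter_upwards [config_wave_ae Ψ n, config_wave_ae Φ n] with x hΨ hΦ
  have hsq : (Real.sqrt (n.factorial) : ℂ) * Real.sqrt (n.factorial) = n.factorial := by
    exact_mod_cast Real.mul_self_sqrt (Nat.cast_nonneg n.factorial)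
  have hne : (n.factorial : ℂ) ≠ 0 := by exact_mod_cast n.factorial_ne_zero
  rw [hΨ, hΦ, map_mul, Complex.conj_ofReal, mul_mul_mul_comm, hsq, Complex.real_smul,
    Complex.ofReal_inv, Complex.ofReal_natCast, inv_mul_cancel_left₀ hne, RCLike.inner_apply']
  rfl

theorem inner_ofConfig (Ψ : Fock I)
    (hF : MemLp (fun ω : Configuration ℝ => F ω.points) 2 (configMeasure (volume.restrict I))) :
    inner ℂ Ψ (ofConfig hF) =
      ∫ ω, conj (config (wave Ψ) ω.points) * F ω.points ∂(configMeasure (volume.restrict I)) := by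
  rw [inner_eq_integral_config]
  refine integral_congr_ae ((config_ofConfig_ae hF).mono fun ω hω => ?_)
  simp only [hω]

end Vectors

/-! ### Bounds and measurability of path-ordered products -/

/-- The sum of the norms of the entries of a matrix.  It bounds every entry and is integrable
whenever the entries are, so products of matrices can be estimated by products of real functions. -/
def entrySum {ι R : Type*} [Fintype ι] [Norm R] (A : Matrix ι ι R) : ℝ := ∑ i, ∑ j, ‖A i j‖

section EntrySum

variable {ι R : Type*} [Fintype ι] [SeminormedRing R]

theorem entrySum_nonneg (A : Matrix ι ι R) : 0 ≤ entrySum A :=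
  Finset.sum_nonneg fun _ _ => Finset.sum_nonneg fun _ _ => norm_nonneg _

theorem prod_entrySum_nonneg {X : Type*} (A : X → Matrix ι ι R) (s : Finset X) :
    0 ≤ ∏ t ∈ s, entrySum (A t) :=
  Finset.prod_nonneg fun _ _ => entrySum_nonneg _

theorem norm_mul_apply_le (A X : Matrix ι ι R) {c : ℝ} (hX : ∀ i j, ‖X i j‖ ≤ c) (i j : ι) :
    ‖(A * X) i j‖ ≤ (∑ k, ‖A i k‖) * c := by
  rw [Matrix.mul_apply, Finset.sum_mul]
  exact norm_sum_le_of_le _ fun k _ => (norm_mul_le _ _).trans (by gcongr; exact hX k j)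

section OrderedProd

variable [DecidableEq ι] [NormOneClass R] {α : Type*} [LinearOrder α]

theorem norm_orderedProd_apply_le (f : α → Matrix ι ι R) (σ : Finset α) (i j : ι) :
    ‖orderedProd f σ i j‖ ≤ orderedProd (fun t => entrySum (f t)) σ := by
  induction σ using Finset.induction_on_min generalizing i j with
  | empty => by_cases h : i = j <;> simp [h]
  | insert a σ ha ih =>
    rw [orderedProd_insert _ ha, orderedProd_insert _ ha]
    refine (norm_mul_apply_le _ _ ih i j).trans (mul_le_mul_of_nonneg_right ?_ ?_)
    · exact Finset.single_le_sum (f := fun i => ∑ k, ‖f a i k‖)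
        (fun i _ => Finset.sum_nonneg fun _ _ => norm_nonneg _) (Finset.mem_univ i)
    · rw [orderedProd_eq_prod]
      exact prod_entrySum_nonneg f σ

theorem norm_trace_orderedProd_le (B : Matrix ι ι R) (f : α → Matrix ι ι R) (σ : Finset α) :
    ‖(B * orderedProd f σ).trace‖ ≤ entrySum B * orderedProd (fun t => entrySum (f t)) σ := by
  rw [Matrix.trace, entrySum, Finset.sum_mul]
  exact norm_sum_le_of_le _ fun i _ => norm_mul_apply_le _ _ (norm_orderedProd_apply_le f σ) i i

end OrderedProd

end EntrySum

theorem memLp_entrySum {ι X E : Type*} [Fintype ι] [NormedAddCommGroup E] [MeasurableSpace X]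
    {μ : Measure X} {p : ENNReal} {A : X → Matrix ι ι E}
    (h : ∀ i j, MemLp (fun x => A x i j) p μ) : MemLp (fun x => entrySum (A x)) p μ :=
  memLp_finsetSum _ fun i _ => memLp_finsetSum _ fun j _ => (h i j).norm

theorem integrable_prod_entrySum {ι X E : Type*} [Fintype ι] [NormedAddCommGroup E]
    [DecidableEq X] [MeasurableSpace X] [MeasurableEq X] {μ : Measure X} [SigmaFinite μ]
    [NullSingletonClass μ] {A : X → Matrix ι ι E} (h : ∀ i j, MemLp (fun x => A x i j) 1 μ) :
    Integrable (fun ω => ∏ t ∈ ω.points, entrySum (A t)) (configMeasure μ) :=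
  integrable_prod_points (memLp_one_iff_integrable.1 (memLp_entrySum h))

theorem orderedProd_piecewise_union {α A : Type*} [LinearOrder α] [CommMonoid A] (f g : α → A)
    {σ τ : Finset α} (h : Disjoint σ τ) :
    orderedProd (σ.piecewise f g) (σ ∪ τ) = (∏ t ∈ σ, f t) * ∏ t ∈ τ, g t := by
  rw [orderedProd_eq_prod, Finset.prod_union h]
  congr 1
  · exact Finset.prod_congr rfl fun t ht => σ.piecewise_eq_of_mem _ _ ht
  · exact Finset.prod_congr rfl fun t ht =>
      σ.piecewise_eq_of_notMem _ _ (Finset.disjoint_right.1 h ht)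

section Measurability

variable {ι R X κ : Type*} [Fintype ι] [DecidableEq ι] [Semiring R] [TopologicalSpace R]
  [IsTopologicalSemiring R] [MeasurableSpace X] {μ : Measure X} {A : κ → X → Matrix ι ι R}

theorem aestronglyMeasurable_list_prod
    (hA : ∀ a i j, AEStronglyMeasurable (fun x => A a x i j) μ) (l : List κ) (i j : ι) :
    AEStronglyMeasurable (fun x => (l.map fun a => A a x).prod i j) μ := by
  induction l generalizing i j with
  | nil => exact aestronglyMeasurable_const
  | cons a l ih =>
    simp only [List.map_cons, List.prod_cons, Matrix.mul_apply]
    exact Finset.aestronglyMeasurable_fun_sum _ fun k _ => (hA a i k).mul (ih k j)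

theorem aestronglyMeasurable_trace_orderedProd [LinearOrder κ] (B : Matrix ι ι R)
    (hA : ∀ a i j, AEStronglyMeasurable (fun x => A a x i j) μ) (S : Finset κ) :
    AEStronglyMeasurable (fun x => (B * orderedProd (fun a => A a x) S).trace) μ := by
  simp only [Matrix.trace, Matrix.diag, Matrix.mul_apply]
  exact Finset.aestronglyMeasurable_fun_sum _ fun i _ =>
    Finset.aestronglyMeasurable_fun_sum _ fun k _ =>
      (aestronglyMeasurable_list_prod hA _ k i).const_mul _

end Measurability

section Dyson

variable {I : Set ℝ}

theorem aestronglyMeasurable_eval_orderedMeasure {E : Type*} [TopologicalSpace E] {m : ℕ}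
    {f : ℝ → E} (hf : AEStronglyMeasurable f (volume.restrict I)) (a : Fin m) :
    AEStronglyMeasurable (fun x => f (x a)) (orderedMeasure I m) :=
  (hf.comp_quasiMeasurePreserving
    (Measure.quasiMeasurePreserving_eval (fun _ => volume.restrict I) a)).mono_measure
      Measure.restrict_le_self

theorem aestronglyMeasurable_config_image (Ψ : Fock I) {m : ℕ} (S : Finset (Fin m)) :
    AEStronglyMeasurable (fun x => config (wave Ψ) (S.image x)) (orderedMeasure I m) :=
  (aestronglyMeasurable_image_image_compl (G := fun σ _ => config (wave Ψ) σ)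
    (memLp_config Ψ).1.comp_fst S).mono_measure Measure.restrict_le_self

theorem HasDysonSum.congr_ae {F F' : (m : ℕ) → (Fin m → ℝ) → ℂ} {s : ℂ} (h : HasDysonSum I F s)
    {p : Finset ℝ → Prop} (hp : ∀ᵐ ω ∂configMeasure (volume.restrict I), p ω.points)
    (hF : ∀ m x, StrictMono x → (∀ S ∈ (Finset.univ.image x).powerset, p S) → F m x = F' m x) :
    HasDysonSum I F' s := by
  have hae : ∀ m, F m =ᵐ[orderedMeasure I m] F' m := fun m => by
    filter_upwards [ae_strictMono I m, ae_restrict_of_ae (ae_forall_mem_powerset_points hp m)]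
      with x hx hpx using hF m x hx hpx
  refine ⟨fun m => (h.1 m).congr (hae m), ?_⟩
  simp only [← fun m => integral_congr_ae (hae m)]
  exact h.2

theorem HasDysonSum.congr {F F' : (m : ℕ) → (Fin m → ℝ) → ℂ} {s : ℂ} (h : HasDysonSum I F s)
    (hF : ∀ m x, StrictMono x → F m x = F' m x) : HasDysonSum I F' s :=
  h.congr_ae (p := fun _ => True) (.of_forall fun _ => trivial) fun m x hx _ => hF m x hx

end Dyson

/-! ### Existence of continuous matrix product states -/

theorem trace_reindex {ι κ R : Type*} [Fintype ι] [Fintype κ] [AddCommMonoid R] (e : ι ≃ κ)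
    (A : Matrix ι ι R) : (Matrix.reindex e e A).trace = A.trace :=
  e.symm.sum_comp fun i => A i i

section State

variable {I : Set ℝ} {ι : Type} [Fintype ι] [DecidableEq ι]

/-- `Tr_D(B ∏ …)` for the path-ordered product over `σ ∪ τ` with factors `L` at the points of `σ`
and `Q` at the points of `τ`.  It is set to zero on overlapping configurations, which are null. -/
def stateKernel (B : Matrix ι ι ℂ) (Q L : ℝ → Matrix ι ι ℂ) (σ τ : Finset ℝ) : ℂ :=
  if Disjoint σ τ then (B * orderedProd (σ.piecewise L Q) (σ ∪ τ)).trace else 0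

/-- The value of a cMPS on the configuration `σ`: the positions of the factors `Q` are integrated
out. -/
def stateAmplitude (I : Set ℝ) (B : Matrix ι ι ℂ) (Q L : ℝ → Matrix ι ι ℂ) (σ : Finset ℝ) : ℂ :=
  ∫ ω, stateKernel B Q L σ ω.points ∂configMeasure (volume.restrict I)

variable (B : Matrix ι ι ℂ) {Q L : ℝ → Matrix ι ι ℂ}

theorem norm_stateKernel_le (Q L : ℝ → Matrix ι ι ℂ) (σ τ : Finset ℝ) :
    ‖stateKernel B Q L σ τ‖ ≤
      entrySum B * (∏ t ∈ σ, entrySum (L t)) * ∏ t ∈ τ, entrySum (Q t) := by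
  unfold stateKernel
  split_ifs with h
  · refine (norm_trace_orderedProd_le _ _ _).trans_eq ?_
    simp only [map_piecewise, orderedProd_piecewise_union _ _ h, mul_assoc]
  · rw [norm_zero]
    exact mul_nonneg (mul_nonneg (entrySum_nonneg _) (prod_entrySum_nonneg _ _))
      (prod_entrySum_nonneg _ _)

theorem aestronglyMeasurable_stateKernel_image (h : StateTensors I Q L) {m : ℕ}
    {S S' : Finset (Fin m)} (hS : Disjoint S S') :
    AEStronglyMeasurable (fun x => stateKernel B Q L (S.image x) (S'.image x))
      (orderedMeasure I m) := by
  have hfactor : ∀ a i j, AEStronglyMeasurable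
      (fun x : Fin m → ℝ => S.piecewise (fun a => L (x a)) (fun a => Q (x a)) a i j)
      (orderedMeasure I m) := fun a i j => by
    simp only [Finset.piecewise]
    split_ifs
    · exact aestronglyMeasurable_eval_orderedMeasure (h.2 i j).1 a
    · exact aestronglyMeasurable_eval_orderedMeasure (h.1 i j).1 a
  refine (aestronglyMeasurable_trace_orderedProd B hfactor (S ∪ S')).congr ?_
  filter_upwards [ae_strictMono I m] with x hx
  rw [stateKernel, if_pos ((Finset.disjoint_image hx.injective).2 hS), ← Finset.image_union,
    orderedProd_image hx]
  simp only [piecewise_image hx.injective]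

theorem aestronglyMeasurable_stateKernel (h : StateTensors I Q L) :
    AEStronglyMeasurable
      (fun p : Configuration ℝ × Configuration ℝ => stateKernel B Q L p.1.points p.2.points)
      ((configMeasure (volume.restrict I)).prod (configMeasure (volume.restrict I))) :=
  aestronglyMeasurable_prod_points fun _ _ =>
    aestronglyMeasurable_stateKernel_image B h disjoint_compl_right

theorem integrable_stateKernel_ae (h : StateTensors I Q L) :
    ∀ᵐ ω ∂configMeasure (volume.restrict I), Integrable
      (fun ω' : Configuration ℝ => stateKernel B Q L ω.points ω'.points)
      (configMeasure (volume.restrict I)) := by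
  filter_upwards [(aestronglyMeasurable_stateKernel B h).prodMk_left] with ω hω
  exact ((integrable_prod_entrySum h.1).const_mul
    (entrySum B * ∏ t ∈ ω.points, entrySum (L t))).mono' hω
    (.of_forall fun ω' => norm_stateKernel_le B Q L ω.points ω'.points)

theorem norm_stateAmplitude_le (h : StateTensors I Q L) (σ : Finset ℝ) :
    ‖stateAmplitude I B Q L σ‖ ≤
      (entrySum B * ∫ ω, ∏ t ∈ ω.points, entrySum (Q t) ∂configMeasure (volume.restrict I)) *
        ∏ t ∈ σ, entrySum (L t) := by
  refine (norm_integral_le_of_norm_le ((integrable_prod_entrySum h.1).const_mul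
    (entrySum B * ∏ t ∈ σ, entrySum (L t)))
    (.of_forall fun ω => norm_stateKernel_le B Q L σ ω.points)).trans_eq ?_
  rw [integral_const_mul]
  ring

theorem memLp_stateAmplitude (h : StateTensors I Q L) :
    MemLp (fun ω : Configuration ℝ => stateAmplitude I B Q L ω.points) 2
      (configMeasure (volume.restrict I)) := by
  refine MemLp.of_le_mul
    (c := entrySum B * ∫ ω, ∏ t ∈ ω.points, entrySum (Q t) ∂configMeasure (volume.restrict I))
    (memLp_prod_points (memLp_entrySum h.2))
    (aestronglyMeasurable_stateKernel B h).integral_prod_right'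
    (.of_forall fun ω => (norm_stateAmplitude_le B h ω.points).trans_eq ?_)
  rw [Real.norm_of_nonneg (prod_entrySum_nonneg L _)]

/-- The Fock vector `|ψ[B,Q,L]⟩`, assembled from its values on configurations. -/
def stateVector (h : StateTensors I Q L) : Fock I := ofConfig (memLp_stateAmplitude B h)

theorem integrable_norm_config_mul_prod_points (Ψ : Fock I) {ℓ q : ℝ → ℝ}
    (hℓ : MemLp ℓ 2 (volume.restrict I)) (hq : Integrable q (volume.restrict I)) :
    Integrable (fun p : Configuration ℝ × Configuration ℝ => ‖config (wave Ψ) p.1.points‖ *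
      (∏ t ∈ p.1.points, ℓ t) * ∏ t ∈ p.2.points, q t)
      ((configMeasure (volume.restrict I)).prod (configMeasure (volume.restrict I))) :=
  ((memLp_config Ψ).norm.integrable_mul (memLp_prod_points hℓ)).mul_prod
    (integrable_prod_points hq)

theorem integrable_conj_config_mul_stateKernel (h : StateTensors I Q L) (Ψ : Fock I) :
    Integrable (fun p : Configuration ℝ × Configuration ℝ =>
      conj (config (wave Ψ) p.1.points) * stateKernel B Q L p.1.points p.2.points)
      ((configMeasure (volume.restrict I)).prod (configMeasure (volume.restrict I))) := by
  refine ((integrable_norm_config_mul_prod_points Ψ (memLp_entrySum h.2)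
    (memLp_one_iff_integrable.1 (memLp_entrySum h.1))).const_mul (entrySum B)).mono'
    ((memLp_config Ψ).star.1.comp_fst.mul (aestronglyMeasurable_stateKernel B h))
    (.of_forall fun p => ?_)
  rw [norm_mul, RCLike.norm_conj]
  refine (mul_le_mul_of_nonneg_left (norm_stateKernel_le B Q L _ _) (norm_nonneg _)).trans_eq ?_
  ring

theorem inner_stateVector (h : StateTensors I Q L) (Ψ : Fock I) :
    inner ℂ Ψ (stateVector B h) = ∫ p : Configuration ℝ × Configuration ℝ,
      conj (config (wave Ψ) p.1.points) * stateKernel B Q L p.1.points p.2.points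
      ∂((configMeasure (volume.restrict I)).prod (configMeasure (volume.restrict I))) := by
  rw [integral_prod _ (integrable_conj_config_mul_stateKernel B h Ψ)]
  simp only [integral_const_mul]
  exact inner_ofConfig Ψ (memLp_stateAmplitude B h)

theorem isCMPS_stateVector (h : StateTensors I Q L) : IsCMPS I B Q L (stateVector B h) := by
  intro Ψ _
  rw [inner_stateVector]
  refine (hasDysonSum_sum_powerset (G := fun σ τ => conj (config (wave Ψ) σ) *
    stateKernel B Q L σ τ) (integrable_conj_config_mul_stateKernel B h Ψ)).congr fun m x hx => ?_
  rw [stateIntegrand_eq_sum B Q L hx]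
  refine Finset.sum_congr rfl fun S hS => ?_
  rw [stateKernel, if_pos Finset.disjoint_sdiff,
    Finset.union_sdiff_of_subset (Finset.mem_powerset.1 hS)]

theorem IsCMPS.unique {B : Matrix ι ι ℂ} {Φ Φ' : Fock I} (h : IsCMPS I B Q L Φ)
    (h' : IsCMPS I B Q L Φ') : Φ = Φ' :=
  ext_finiteParticle fun Ψ hΨ => (h Ψ hΨ).2.unique (h' Ψ hΨ).2

theorem isCMPS_reindex {κ : Type} [Fintype κ] [DecidableEq κ] (e : ι ≃ κ) {B : Matrix ι ι ℂ}
    {Φ : Fock I} (h : IsCMPS I B Q L Φ) :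
    IsCMPS I (Matrix.reindex e e B) (fun x => Matrix.reindex e e (Q x))
      (fun x => Matrix.reindex e e (L x)) Φ := by
  refine fun Ψ hΨ => (h Ψ hΨ).congr fun m x hx => ?_
  rw [stateIntegrand_eq_sum _ _ _ hx, stateIntegrand_eq_sum _ _ _ hx]
  refine Finset.sum_congr rfl fun S _ => congrArg _ ?_
  have hprod : Matrix.reindex e e (B * orderedProd (S.piecewise L Q) (Finset.univ.image x)) =
      Matrix.reindex e e B * orderedProd (S.piecewise (fun t => Matrix.reindex e e (L t))
        fun t => Matrix.reindex e e (Q t)) (Finset.univ.image x) := by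
    simp only [← Matrix.coe_reindexAlgEquiv ℂ ℂ, map_mul, map_orderedProd, map_piecewise]
  rw [← hprod, trace_reindex]

end State

theorem stateTensors_reindex {I : Set ℝ} {ι κ : Type} (e : ι ≃ κ) {Q L : ℝ → Matrix ι ι ℂ}
    (h : StateTensors I Q L) :
    StateTensors I (fun x => Matrix.reindex e e (Q x))
      (fun x => Matrix.reindex e e (L x)) :=
  ⟨fun i j => h.1 (e.symm i) (e.symm j), fun i j => h.2 (e.symm i) (e.symm j)⟩

/-! ### The tensors of the image state -/

section Kronecker

variable {ι₁ ι₂ R : Type*} [Fintype ι₁] [DecidableEq ι₁] [Fintype ι₂] [DecidableEq ι₂]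
  [CommSemiring R]

/-- The embedding `A ↦ A ⊗ 1` of the operator's bond algebra into that of the image state. -/
def kroneckerOne (ι₁ ι₂ R : Type*) [Fintype ι₁] [DecidableEq ι₁] [Fintype ι₂] [DecidableEq ι₂]
    [CommSemiring R] : Matrix ι₁ ι₁ R →* Matrix (ι₁ × ι₂) (ι₁ × ι₂) R where
  toFun A := A ⊗ₖ 1
  map_one' := Matrix.one_kronecker_one
  map_mul' A A' := by rw [← Matrix.mul_kronecker_mul, one_mul]

/-- The embedding `A ↦ 1 ⊗ A` of the state's bond algebra into that of the image state. -/
def oneKronecker (ι₁ ι₂ R : Type*) [Fintype ι₁] [DecidableEq ι₁] [Fintype ι₂] [DecidableEq ι₂]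
    [CommSemiring R] : Matrix ι₂ ι₂ R →* Matrix (ι₁ × ι₂) (ι₁ × ι₂) R where
  toFun A := 1 ⊗ₖ A
  map_one' := Matrix.one_kronecker_one
  map_mul' A A' := by rw [← Matrix.mul_kronecker_mul, one_mul]

theorem kroneckerOne_mul_oneKronecker (A : Matrix ι₁ ι₁ R) (A' : Matrix ι₂ ι₂ R) :
    kroneckerOne ι₁ ι₂ R A * oneKronecker ι₁ ι₂ R A' = A ⊗ₖ A' := by
  change A ⊗ₖ 1 * 1 ⊗ₖ A' = _
  rw [← Matrix.mul_kronecker_mul, mul_one, one_mul]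

theorem commute_oneKronecker_kroneckerOne (A : Matrix ι₁ ι₁ R) (A' : Matrix ι₂ ι₂ R) :
    Commute (oneKronecker ι₁ ι₂ R A') (kroneckerOne ι₁ ι₂ R A) := by
  change 1 ⊗ₖ A' * A ⊗ₖ 1 = A ⊗ₖ 1 * 1 ⊗ₖ A'
  rw [← Matrix.mul_kronecker_mul, ← Matrix.mul_kronecker_mul, mul_one, one_mul, mul_one, one_mul]

theorem sum_smul_orderedProd_kronecker_orderedProd {α : Type*} [LinearOrder α]
    (Q₁ L₁ R₁ T₁ : α → Matrix ι₁ ι₁ R) (Q₂ L₂ : α → Matrix ι₂ ι₂ R) (c : Finset α → R)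
    (ρ : Finset α) :
    ∑ σ ∈ ρ.powerset, ∑ S ∈ σ.powerset, ∑ U ∈ σ.powerset,
        c S • (orderedProd (ladderFactor S U Q₁ L₁ R₁ T₁) σ ⊗ₖ
          orderedProd (U.piecewise L₂ Q₂) (U ∪ ρ \ σ)) =
      ∑ S ∈ ρ.powerset, c S • orderedProd
        (S.piecewise (fun t => L₁ t ⊗ₖ (1 : Matrix ι₂ ι₂ R) + T₁ t ⊗ₖ L₂ t)
          fun t => Q₁ t ⊗ₖ (1 : Matrix ι₂ ι₂ R) + (1 : Matrix ι₁ ι₁ R) ⊗ₖ Q₂ t + R₁ t ⊗ₖ L₂ t)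
        ρ := by
  simp only [← kroneckerOne_mul_oneKronecker, map_orderedProd, map_ladderFactor, map_piecewise,
    map_one, mul_one, one_mul]
  refine sum_smul_orderedProd_ladderFactor_mul _ _ _ _ _ _ (fun s t S U => ?_)
    (fun s t S U => ?_) ρ c
  all_goals
    rw [← map_ladderFactor]
    exact commute_oneKronecker_kroneckerOne _ _

theorem sum_trace_mul_trace {α : Type*} [LinearOrder α]
    (B₁ : Matrix ι₁ ι₁ R) (Q₁ L₁ R₁ T₁ : α → Matrix ι₁ ι₁ R)
    (B₂ : Matrix ι₂ ι₂ R) (Q₂ L₂ : α → Matrix ι₂ ι₂ R) (c : Finset α → R) (ρ : Finset α) :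
    ∑ σ ∈ ρ.powerset, ∑ S ∈ σ.powerset, ∑ U ∈ σ.powerset,
        c S * ((B₁ * orderedProd (ladderFactor S U Q₁ L₁ R₁ T₁) σ).trace *
          (B₂ * orderedProd (U.piecewise L₂ Q₂) (U ∪ ρ \ σ)).trace) =
      ∑ S ∈ ρ.powerset, c S * ((B₁ ⊗ₖ B₂) * orderedProd
        (S.piecewise (fun t => L₁ t ⊗ₖ (1 : Matrix ι₂ ι₂ R) + T₁ t ⊗ₖ L₂ t)
          fun t => Q₁ t ⊗ₖ (1 : Matrix ι₂ ι₂ R) + (1 : Matrix ι₁ ι₁ R) ⊗ₖ Q₂ t + R₁ t ⊗ₖ L₂ t)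
        ρ).trace := by
  have htrace := congrArg (fun X => ((B₁ ⊗ₖ B₂) * X).trace)
    (sum_smul_orderedProd_kronecker_orderedProd Q₁ L₁ R₁ T₁ Q₂ L₂ c ρ)
  simpa only [Finset.mul_sum, Matrix.trace_sum, Matrix.mul_smul, Matrix.trace_smul, smul_eq_mul,
    ← Matrix.mul_kronecker_mul, Matrix.trace_kronecker] using htrace

end Kronecker

theorem stateTensors_kronecker {I : Set ℝ} {ι₁ ι₂ : Type} [DecidableEq ι₁] [DecidableEq ι₂]
    {Q₁ L₁ R₁ T₁ : ℝ → Matrix ι₁ ι₁ ℂ} {Q₂ L₂ : ℝ → Matrix ι₂ ι₂ ℂ}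
    (h₁ : OperatorTensors I Q₁ L₁ R₁ T₁) (h₂ : StateTensors I Q₂ L₂) :
    StateTensors I
      (fun x => Q₁ x ⊗ₖ (1 : Matrix ι₂ ι₂ ℂ) + (1 : Matrix ι₁ ι₁ ℂ) ⊗ₖ Q₂ x + R₁ x ⊗ₖ L₂ x)
      (fun x => L₁ x ⊗ₖ (1 : Matrix ι₂ ι₂ ℂ) + T₁ x ⊗ₖ L₂ x) := by
  obtain ⟨⟨hQ₁, hL₁⟩, hR₁, hT₁⟩ := h₁
  obtain ⟨hQ₂, hL₂⟩ := h₂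
  refine ⟨fun i j => ?_, fun i j => ?_⟩
  · simp only [Matrix.add_apply, Matrix.kroneckerMap_apply]
    exact (((hQ₁ _ _).mul_const _).add ((hQ₂ _ _).const_mul _)).add (MemLp.mul' (hL₂ _ _) (hR₁ _ _))
  · simp only [Matrix.add_apply, Matrix.kroneckerMap_apply]
    exact ((hL₁ _ _).mul_const _).add (MemLp.mul' (hL₂ _ _) (hT₁ _ _))

theorem operatorTensors_zero_one {I : Set ℝ} {ι : Type} [DecidableEq ι] {Q L : ℝ → Matrix ι ι ℂ}
    (h : StateTensors I Q L) : OperatorTensors I Q L (fun _ => 0) fun _ => 1 :=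
  ⟨h, fun _ _ => MemLp.zero', fun _ _ => memLp_top_const _⟩

/-! ### The action of a continuous matrix product operator -/

section Operator

variable {I : Set ℝ} {ι₁ ι₂ : Type} [Fintype ι₁] [DecidableEq ι₁] [Fintype ι₂] [DecidableEq ι₂]
  (B₁ : Matrix ι₁ ι₁ ℂ) (B₂ : Matrix ι₂ ι₂ ℂ)

/-- The integrand of `⟨ψ|O₁|ψ[B₂,Q₂,L₂]⟩`: the operator acts at the points of `σ`, and `τ` are the
points where the state contributes `Q₂`. -/
def actionKernel (B₁ : Matrix ι₁ ι₁ ℂ) (Q₁ L₁ R₁ T₁ : ℝ → Matrix ι₁ ι₁ ℂ) (B₂ : Matrix ι₂ ι₂ ℂ)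
    (Q₂ L₂ : ℝ → Matrix ι₂ ι₂ ℂ) (ψ : Wave) (σ τ : Finset ℝ) : ℂ :=
  ∑ S ∈ σ.powerset, ∑ U ∈ σ.powerset, conj (config ψ S) *
    ((B₁ * orderedProd (ladderFactor S U Q₁ L₁ R₁ T₁) σ).trace * stateKernel B₂ Q₂ L₂ U τ)

section Bound

variable (Q₁ L₁ R₁ T₁ : ℝ → Matrix ι₁ ι₁ ℂ) (Q₂ L₂ : ℝ → Matrix ι₂ ι₂ ℂ) (ψ : Wave)

theorem norm_actionKernel_le {σ τ : Finset ℝ} (h : Disjoint σ τ) :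
    ‖actionKernel B₁ Q₁ L₁ R₁ T₁ B₂ Q₂ L₂ ψ σ τ‖ ≤
      ∑ S ∈ σ.powerset, ∑ U ∈ σ.powerset, (entrySum B₁ * entrySum B₂ * ‖config ψ S‖) •
        (orderedProd (ladderFactor S U (fun t => entrySum (Q₁ t)) (fun t => entrySum (L₁ t))
          (fun t => entrySum (R₁ t)) fun t => entrySum (T₁ t)) σ *
        orderedProd (U.piecewise (fun t => entrySum (L₂ t)) fun t => entrySum (Q₂ t)) (U ∪ τ)) := by
  refine norm_sum_le_of_le _ fun S _ => norm_sum_le_of_le _ fun U hU => ?_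
  have hUτ : Disjoint U τ := h.mono_left (Finset.mem_powerset.1 hU)
  have hoperator := norm_trace_orderedProd_le B₁ (ladderFactor S U Q₁ L₁ R₁ T₁) σ
  simp only [map_ladderFactor] at hoperator
  rw [norm_mul, norm_mul, RCLike.norm_conj, orderedProd_piecewise_union _ _ hUτ]
  refine (mul_le_mul_of_nonneg_left (mul_le_mul hoperator (norm_stateKernel_le B₂ Q₂ L₂ U τ)
    (norm_nonneg _) ((norm_nonneg _).trans hoperator)) (norm_nonneg _)).trans_eq ?_
  rw [smul_eq_mul]
  ring

/-- The bound has the same algebraic form as the kernel, so the identity which computes the image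
state, now read in the commutative ring `ℝ`, also sums the bound. -/
theorem sum_norm_actionKernel_le (ρ : Finset ℝ) :
    ∑ σ ∈ ρ.powerset, ‖actionKernel B₁ Q₁ L₁ R₁ T₁ B₂ Q₂ L₂ ψ σ (ρ \ σ)‖ ≤
      ∑ S ∈ ρ.powerset, entrySum B₁ * entrySum B₂ * (‖config ψ S‖ *
        (∏ t ∈ S, (entrySum (L₁ t) + entrySum (T₁ t) * entrySum (L₂ t))) *
        ∏ t ∈ ρ \ S, (entrySum (Q₁ t) + entrySum (Q₂ t) + entrySum (R₁ t) * entrySum (L₂ t))) := by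
  refine (Finset.sum_le_sum fun σ _ => norm_actionKernel_le B₁ B₂ Q₁ L₁ R₁ T₁ Q₂ L₂ ψ
    Finset.disjoint_sdiff).trans_eq ?_
  rw [sum_smul_orderedProd_ladderFactor_mul _ _ _ _ _ _ (fun _ _ _ _ => Commute.all _ _)
    (fun _ _ _ _ => Commute.all _ _) ρ fun S => entrySum B₁ * entrySum B₂ * ‖config ψ S‖]
  refine Finset.sum_congr rfl fun S hS => ?_
  have hρ : S ∪ ρ \ S = ρ := Finset.union_sdiff_of_subset (Finset.mem_powerset.1 hS)
  conv_lhs => rw [← hρ]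
  rw [orderedProd_piecewise_union _ _ Finset.disjoint_sdiff, smul_eq_mul]
  ring

end Bound

variable {Q₁ L₁ R₁ T₁ : ℝ → Matrix ι₁ ι₁ ℂ} {Q₂ L₂ : ℝ → Matrix ι₂ ι₂ ℂ}

theorem aestronglyMeasurable_trace_ladderFactor_image (h : OperatorTensors I Q₁ L₁ R₁ T₁) {m : ℕ}
    (S U V : Finset (Fin m)) :
    AEStronglyMeasurable (fun x => (B₁ * orderedProd
      (ladderFactor (S.image x) (U.image x) Q₁ L₁ R₁ T₁) (V.image x)).trace)
      (orderedMeasure I m) := by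
  have hfactor : ∀ a i j, AEStronglyMeasurable (fun x : Fin m → ℝ =>
      ladderFactor S U (fun a => Q₁ (x a)) (fun a => L₁ (x a)) (fun a => R₁ (x a))
        (fun a => T₁ (x a)) a i j) (orderedMeasure I m) := fun a i j => by
    simp only [ladderFactor, Finset.piecewise]
    split_ifs
    · exact aestronglyMeasurable_eval_orderedMeasure (h.2.2 i j).1 a
    · exact aestronglyMeasurable_eval_orderedMeasure (h.2.1 i j).1 a
    · exact aestronglyMeasurable_eval_orderedMeasure (h.1.2 i j).1 a
    · exact aestronglyMeasurable_eval_orderedMeasure (h.1.1 i j).1 a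
  refine (aestronglyMeasurable_trace_orderedProd B₁ hfactor V).congr ?_
  filter_upwards [ae_strictMono I m] with x hx
  simp only [orderedProd_image hx, ladderFactor_image hx.injective]

theorem aestronglyMeasurable_actionKernel (h₁ : OperatorTensors I Q₁ L₁ R₁ T₁)
    (h₂ : StateTensors I Q₂ L₂) (Ψ : Fock I) :
    AEStronglyMeasurable (fun p : Configuration ℝ × Configuration ℝ =>
      actionKernel B₁ Q₁ L₁ R₁ T₁ B₂ Q₂ L₂ (wave Ψ) p.1.points p.2.points)
      ((configMeasure (volume.restrict I)).prod (configMeasure (volume.restrict I))) := by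
  refine aestronglyMeasurable_prod_points fun m V => ?_
  have hsum : AEStronglyMeasurable (fun x : Fin m → ℝ =>
      ∑ S ∈ V.powerset, ∑ U ∈ V.powerset, conj (config (wave Ψ) (S.image x)) *
        ((B₁ * orderedProd (ladderFactor (S.image x) (U.image x) Q₁ L₁ R₁ T₁) (V.image x)).trace *
          stateKernel B₂ Q₂ L₂ (U.image x) (Vᶜ.image x))) (orderedMeasure I m) :=
    Finset.aestronglyMeasurable_fun_sum _ fun S _ =>
      Finset.aestronglyMeasurable_fun_sum _ fun U hU =>
        (aestronglyMeasurable_config_image Ψ S).star.mul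
          ((aestronglyMeasurable_trace_ladderFactor_image B₁ h₁ S U V).mul
            (aestronglyMeasurable_stateKernel_image B₂ h₂
              (disjoint_compl_right.mono_left (Finset.mem_powerset.1 hU))))
  refine hsum.congr ?_
  filter_upwards [ae_strictMono I m] with x hx
  have hinj : Set.InjOn _ (V.powerset : Set (Finset (Fin m))) :=
    (Finset.image_injective hx.injective).injOn
  simp only [actionKernel, Finset.powerset_image, Finset.sum_image hinj]

theorem integrable_actionKernel (h₁ : OperatorTensors I Q₁ L₁ R₁ T₁)
    (h₂ : StateTensors I Q₂ L₂) (Ψ : Fock I) :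
    Integrable (fun p : Configuration ℝ × Configuration ℝ =>
      actionKernel B₁ Q₁ L₁ R₁ T₁ B₂ Q₂ L₂ (wave Ψ) p.1.points p.2.points)
      ((configMeasure (volume.restrict I)).prod (configMeasure (volume.restrict I))) := by
  have hℓ : MemLp (fun t => entrySum (L₁ t) + entrySum (T₁ t) * entrySum (L₂ t)) 2
      (volume.restrict I) :=
    (memLp_entrySum h₁.1.2).add (MemLp.mul' (memLp_entrySum h₂.2) (memLp_entrySum h₁.2.2))
  have hq : MemLp (fun t => entrySum (Q₁ t) + entrySum (Q₂ t) + entrySum (R₁ t) * entrySum (L₂ t))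
      1 (volume.restrict I) :=
    ((memLp_entrySum h₁.1.1).add (memLp_entrySum h₂.1)).add
      (MemLp.mul' (memLp_entrySum h₂.2) (memLp_entrySum h₁.2.1))
  have hbound := (integrable_norm_config_mul_prod_points Ψ hℓ
    (memLp_one_iff_integrable.1 hq)).const_mul (entrySum B₁ * entrySum B₂)
  exact integrable_of_sum_powerset_norm_le (F := fun S τ => entrySum B₁ * entrySum B₂ *
    (‖config (wave Ψ) S‖ * (∏ t ∈ S, (entrySum (L₁ t) + entrySum (T₁ t) * entrySum (L₂ t))) *
    ∏ t ∈ τ, (entrySum (Q₁ t) + entrySum (Q₂ t) + entrySum (R₁ t) * entrySum (L₂ t))))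
    (aestronglyMeasurable_actionKernel B₁ B₂ h₁ h₂ Ψ) hbound
    fun ρ => sum_norm_actionKernel_le B₁ B₂ Q₁ L₁ R₁ T₁ Q₂ L₂ (wave Ψ) ρ

theorem operatorIntegrand_stateVector (h₂ : StateTensors I Q₂ L₂) (ψ : Wave) {m : ℕ}
    {x : Fin m → ℝ} (hx : StrictMono x)
    (hstate : ∀ U ∈ (Finset.univ.image x).powerset,
      config (wave (stateVector B₂ h₂)) U = stateAmplitude I B₂ Q₂ L₂ U ∧
        Integrable (fun ω : Configuration ℝ => stateKernel B₂ Q₂ L₂ U ω.points)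
          (configMeasure (volume.restrict I))) :
    operatorIntegrand B₁ Q₁ L₁ R₁ T₁ m x ψ (wave (stateVector B₂ h₂)) =
      ∫ ω, actionKernel B₁ Q₁ L₁ R₁ T₁ B₂ Q₂ L₂ ψ (Finset.univ.image x) ω.points
        ∂configMeasure (volume.restrict I) := by
  have hterm := fun (c c' : ℂ) U hU => ((hstate U hU).2.const_mul c').const_mul c
  simp only [actionKernel]
  rw [operatorIntegrand_eq_sum _ _ _ _ _ hx,
    integral_finsetSum _ fun S _ => integrable_finsetSum _ fun U hU => hterm _ _ U hU]
  refine Finset.sum_congr rfl fun S _ => ?_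
  rw [integral_finsetSum _ fun U hU => hterm _ _ U hU]
  refine Finset.sum_congr rfl fun U hU => ?_
  rw [integral_const_mul, integral_const_mul, (hstate U hU).1, stateAmplitude]
  ring

theorem sum_actionKernel_eq_stateIntegrand (Q₁ L₁ R₁ T₁ : ℝ → Matrix ι₁ ι₁ ℂ)
    (Q₂ L₂ : ℝ → Matrix ι₂ ι₂ ℂ) (ψ : Wave) {m : ℕ} {x : Fin m → ℝ} (hx : StrictMono x) :
    ∑ σ ∈ (Finset.univ.image x).powerset,
        actionKernel B₁ Q₁ L₁ R₁ T₁ B₂ Q₂ L₂ ψ σ (Finset.univ.image x \ σ) =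
      stateIntegrand (B₁ ⊗ₖ B₂)
        (fun x => Q₁ x ⊗ₖ (1 : Matrix ι₂ ι₂ ℂ) + (1 : Matrix ι₁ ι₁ ℂ) ⊗ₖ Q₂ x + R₁ x ⊗ₖ L₂ x)
        (fun x => L₁ x ⊗ₖ (1 : Matrix ι₂ ι₂ ℂ) + T₁ x ⊗ₖ L₂ x) m x ψ := by
  rw [stateIntegrand_eq_sum _ _ _ hx, ← sum_trace_mul_trace]
  refine Finset.sum_congr rfl fun σ _ => Finset.sum_congr rfl fun S _ =>
    Finset.sum_congr rfl fun U hU => ?_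
  rw [stateKernel, if_pos (Finset.disjoint_sdiff.mono_left (Finset.mem_powerset.1 hU))]

theorem operatorAction_stateVector (h₁ : OperatorTensors I Q₁ L₁ R₁ T₁)
    (h₂ : StateTensors I Q₂ L₂) :
    OperatorAction I B₁ Q₁ L₁ R₁ T₁ (stateVector B₂ h₂)
      (stateVector (B₁ ⊗ₖ B₂) (stateTensors_kronecker h₁ h₂)) := by
  intro Ψ hΨ
  have hkernel := integrable_actionKernel B₁ B₂ h₁ h₂ Ψ
  have himage := (hasDysonSum_sum_powerset (G := actionKernel B₁ Q₁ L₁ R₁ T₁ B₂ Q₂ L₂ (wave Ψ))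
    hkernel).congr fun m x hx =>
    sum_actionKernel_eq_stateIntegrand B₁ B₂ Q₁ L₁ R₁ T₁ Q₂ L₂ (wave Ψ) hx
  rw [(isCMPS_stateVector (B₁ ⊗ₖ B₂) (stateTensors_kronecker h₁ h₂) Ψ hΨ).2.unique himage.2,
    integral_prod _ hkernel]
  exact (hasDysonSum_of_integrable (f := fun σ => ∫ ω, actionKernel B₁ Q₁ L₁ R₁ T₁ B₂ Q₂ L₂
    (wave Ψ) σ ω.points ∂configMeasure (volume.restrict I)) hkernel.integral_prod_left).congr_ae
      (p := fun U => config (wave (stateVector B₂ h₂)) U = stateAmplitude I B₂ Q₂ L₂ U ∧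
        Integrable (fun ω : Configuration ℝ => stateKernel B₂ Q₂ L₂ U ω.points)
          (configMeasure (volume.restrict I)))
      ((config_ofConfig_ae (memLp_stateAmplitude B₂ h₂)).and (integrable_stateKernel_ae B₂ h₂))
      fun m x hx hstate => (operatorIntegrand_stateVector B₁ B₂ h₂ (wave Ψ) hx hstate).symm

end Operator

theorem wave_vacuum_ae (I : Set ℝ) (n : ℕ) :
    ∀ᵐ x ∂(cubeMeasure I n), wave (vacuum I) n x = if n = 0 then 1 else 0 := by
  cases n with
  | zero =>
    have hcomponent : (vacuum I 0 : Lp ℂ 2 (cubeMeasure I 0)) = (memLp_one_zero I).toLp _ := by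
      rw [vacuum, lp.single_apply_self]
    filter_upwards [(memLp_one_zero I).coeFn_toLp] with x hx
    rw [wave, hcomponent, hx, if_pos rfl]
  | succ n =>
    have hcomponent : (vacuum I (n + 1) : Lp ℂ 2 (cubeMeasure I (n + 1))) = 0 := by
      rw [vacuum, lp.single_apply_ne _ _ _ n.succ_ne_zero, ZeroMemClass.coe_zero]
    filter_upwards [Lp.coeFn_zero ℂ 2 (cubeMeasure I (n + 1))] with x hx
    rw [wave, hcomponent, hx, if_neg n.succ_ne_zero, Pi.zero_apply]

theorem config_vacuum_ae (I : Set ℝ) :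
    ∀ᵐ ω ∂configMeasure (volume.restrict I),
      config (wave (vacuum I)) ω.points = if ω.points = ∅ then 1 else 0 := by
  refine ae_configMeasure.2 fun n => ?_
  filter_upwards [config_wave_ae (vacuum I) n, wave_vacuum_ae I n] with x hconfig hwave
  rw [hconfig, hwave]
  cases n with
  | zero => simp [Configuration.points]
  | succ n => simp [Configuration.points, Finset.univ_nonempty.ne_empty]

theorem operatorAction_vacuum {I : Set ℝ} {ι : Type} [Fintype ι] [DecidableEq ι]
    {B : Matrix ι ι ℂ} {Q L : ℝ → Matrix ι ι ℂ} (R T : ℝ → Matrix ι ι ℂ) {Φ : Fock I}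
    (h : IsCMPS I B Q L Φ) : OperatorAction I B Q L R T (vacuum I) Φ := by
  refine fun Ψ hΨ => (h Ψ hΨ).congr_ae
    (p := fun U => config (wave (vacuum I)) U = if U = ∅ then 1 else 0) (config_vacuum_ae I)
    fun m x hx hvacuum => ?_
  rw [operatorIntegrand_eq_sum _ _ _ _ _ hx, stateIntegrand_eq_sum _ _ _ hx]
  refine Finset.sum_congr rfl fun S _ => ?_
  have hempty := Finset.empty_mem_powerset (Finset.univ.image x)
  rw [Finset.sum_eq_single_of_mem ∅ hempty fun U hU hne => by
    rw [hvacuum U hU, if_neg hne, mul_zero, zero_mul], hvacuum ∅ hempty, if_pos rfl, mul_one,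
    ladderFactor, Finset.piecewise_empty]

end CMPO

end

theorem mainTheorem2_general (I : Set ℝ) {ι₁ ι₂ : Type} [Fintype ι₁] [DecidableEq ι₁] [Fintype ι₂]
    [DecidableEq ι₂] (B₁ : Matrix ι₁ ι₁ ℂ) (Q₁ L₁ R₁ T₁ : ℝ → Matrix ι₁ ι₁ ℂ)
    (h₁ : CMPO.OperatorTensors I Q₁ L₁ R₁ T₁) (B₂ : Matrix ι₂ ι₂ ℂ) (Q₂ L₂ : ℝ → Matrix ι₂ ι₂ ℂ)
    (h₂ : CMPO.StateTensors I Q₂ L₂) :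
    (∃! Φ : CMPO.Fock I, CMPO.IsCMPS I B₂ Q₂ L₂ Φ) ∧
    ∀ Φ : CMPO.Fock I, CMPO.IsCMPS I B₂ Q₂ L₂ Φ →
      (CMPO.OperatorTensors I Q₂ L₂ (fun _ => 0) (fun _ => 1) ∧
        ∃ h : CMPO.vacuum I ∈ (CMPO.cMPO I B₂ Q₂ L₂ (fun _ => 0) (fun _ => 1)).domain,
          CMPO.cMPO I B₂ Q₂ L₂ (fun _ => 0) (fun _ => 1) ⟨CMPO.vacuum I, h⟩ = Φ) ∧
      ∃ h : Φ ∈ (CMPO.cMPO I B₁ Q₁ L₁ R₁ T₁).domain,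
        (CMPO.StateTensors I
            (fun x => Q₁ x ⊗ₖ (1 : Matrix ι₂ ι₂ ℂ) + (1 : Matrix ι₁ ι₁ ℂ) ⊗ₖ Q₂ x + R₁ x ⊗ₖ L₂ x)
            (fun x => L₁ x ⊗ₖ (1 : Matrix ι₂ ι₂ ℂ) + T₁ x ⊗ₖ L₂ x) ∧
          CMPO.IsCMPS I (B₁ ⊗ₖ B₂)
            (fun x => Q₁ x ⊗ₖ (1 : Matrix ι₂ ι₂ ℂ) + (1 : Matrix ι₁ ι₁ ℂ) ⊗ₖ Q₂ x + R₁ x ⊗ₖ L₂ x)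
            (fun x => L₁ x ⊗ₖ (1 : Matrix ι₂ ι₂ ℂ) + T₁ x ⊗ₖ L₂ x)
            (CMPO.cMPO I B₁ Q₁ L₁ R₁ T₁ ⟨Φ, h⟩)) ∧
        ∃ D : ℕ, D ≤ Fintype.card ι₁ * Fintype.card ι₂ ∧ ∃ (B : Matrix (Fin D) (Fin D) ℂ)
          (Q L : ℝ → Matrix (Fin D) (Fin D) ℂ), CMPO.StateTensors I Q L ∧
            CMPO.IsCMPS I B Q L (CMPO.cMPO I B₁ Q₁ L₁ R₁ T₁ ⟨Φ, h⟩) := by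
  have hstate := CMPO.isCMPS_stateVector B₂ h₂
  refine ⟨⟨_, hstate, fun Φ hΦ => hΦ.unique hstate⟩, fun Φ hΦ => ⟨⟨CMPO.operatorTensors_zero_one h₂,
    CMPO.cMPO_apply_eq_iff.2 (CMPO.operatorAction_vacuum _ _ hΦ)⟩, ?_⟩⟩
  obtain rfl := hΦ.unique hstate
  obtain ⟨hdomain, happly⟩ := CMPO.cMPO_apply_eq_iff.2 (CMPO.operatorAction_stateVector B₁ B₂ h₁ h₂)
  have htensors := CMPO.stateTensors_kronecker h₁ h₂
  have himage := CMPO.isCMPS_stateVector (B₁ ⊗ₖ B₂) htensors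
  rw [← happly] at himage
  exact ⟨hdomain, ⟨htensors, himage⟩, Fintype.card (ι₁ × ι₂), (Fintype.card_prod _ _).le, _, _, _,
    CMPO.stateTensors_reindex (Fintype.equivFin _) htensors,
    CMPO.isCMPS_reindex (Fintype.equivFin _) himage⟩

theorem mainTheorem2 (I : Set ℝ) (hI : I.OrdConnected) (D₁ D₂ : ℕ)
    (B₁ : Matrix (Fin D₁) (Fin D₁) ℂ) (Q₁ L₁ R₁ T₁ : ℝ → Matrix (Fin D₁) (Fin D₁) ℂ)
    (h₁ : CMPO.OperatorTensors I Q₁ L₁ R₁ T₁)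
    (B₂ : Matrix (Fin D₂) (Fin D₂) ℂ) (Q₂ L₂ : ℝ → Matrix (Fin D₂) (Fin D₂) ℂ)
    (h₂ : CMPO.StateTensors I Q₂ L₂) :
    -- the cMPS `|ψ[B₂,Q₂,L₂]⟩` is a well-defined vector of Fock space
    (∃! Φ : CMPO.Fock I, CMPO.IsCMPS I B₂ Q₂ L₂ Φ) ∧
    ∀ Φ : CMPO.Fock I, CMPO.IsCMPS I B₂ Q₂ L₂ Φ →
      -- it equals `O₂|Ω⟩` for the cMPO `O₂` with tensors `(B₂, Q₂, L₂, 0, 1)`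
      (CMPO.OperatorTensors I Q₂ L₂ (fun _ => 0) (fun _ => 1) ∧
        ∃ h : CMPO.vacuum I ∈ (CMPO.cMPO I B₂ Q₂ L₂ (fun _ => 0) (fun _ => 1)).domain,
          CMPO.cMPO I B₂ Q₂ L₂ (fun _ => 0) (fun _ => 1) ⟨CMPO.vacuum I, h⟩ = Φ) ∧
      ∃ h : Φ ∈ (CMPO.cMPO I B₁ Q₁ L₁ R₁ T₁).domain,
        -- `O₁` maps it to the cMPS with the stated tensors
        (CMPO.StateTensors I
            (fun x => Q₁ x ⊗ₖ (1 : Matrix (Fin D₂) (Fin D₂) ℂ) +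
              (1 : Matrix (Fin D₁) (Fin D₁) ℂ) ⊗ₖ Q₂ x + R₁ x ⊗ₖ L₂ x)
            (fun x => L₁ x ⊗ₖ (1 : Matrix (Fin D₂) (Fin D₂) ℂ) + T₁ x ⊗ₖ L₂ x) ∧
          CMPO.IsCMPS I (B₁ ⊗ₖ B₂)
            (fun x => Q₁ x ⊗ₖ (1 : Matrix (Fin D₂) (Fin D₂) ℂ) +
              (1 : Matrix (Fin D₁) (Fin D₁) ℂ) ⊗ₖ Q₂ x + R₁ x ⊗ₖ L₂ x)
            (fun x => L₁ x ⊗ₖ (1 : Matrix (Fin D₂) (Fin D₂) ℂ) + T₁ x ⊗ₖ L₂ x)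
            (CMPO.cMPO I B₁ Q₁ L₁ R₁ T₁ ⟨Φ, h⟩)) ∧
        -- in particular to a cMPS of bond dimension at most `D₁ D₂`
        ∃ D : ℕ, D ≤ D₁ * D₂ ∧ ∃ (B : Matrix (Fin D) (Fin D) ℂ)
          (Q L : ℝ → Matrix (Fin D) (Fin D) ℂ), CMPO.StateTensors I Q L ∧
            CMPO.IsCMPS I B Q L (CMPO.cMPO I B₁ Q₁ L₁ R₁ T₁ ⟨Φ, h⟩) := by
  simpa only [Fintype.card_fin] using mainTheorem2_general I B₁ Q₁ L₁ R₁ T₁ h₁ B₂ Q₂ L₂ h₂
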